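/- All manifolds are connected, second countable, Hausdorff, smooth ($C^\infty$), finite-dimensional and without boundary. For a manifold $M$, let $\tau\colon TM\to M$ be the tangent bundle, $\mathring{T}M\subset TM$ the set of nonzero tangent vectors, $C$ the Liouville vector field on $TM$ and $\mathbf J$ the vertical endomorphism of $TTM$ (that is, $\mathbf J\xi$ is the vertical lift of $\tau_*\xi$ to the base point of $\xi$ in $TM$). A *Finsler function* on $M$ is a continuous function $F\colon TM\to\mathbb R$ that is smooth on $\mathring{T}M$, positive on $\mathring{T}M$, satisfies $F(tv)=tF(v)$ for all $t>0$, $v\in TM$, and is elliptic: for every $p\in M$ and every nonzero $v\in T_pM$ the second derivative at $v$ of $F^2|_{T_pM}$ is positive definite. The pair $(M,F)$ is then a *Finsler manifold*, with energy $E=\frac12F^2$. A *spray* is a section $S\colon TM\to TTM$ that is smooth on $\mathring{T}M$, positive-homogeneous of degree $2$ (that is, $S(tv)=t\,(\mu_t)_*S(v)$ for $t>0$, where $\mu_t(v)=tv$), and satisfies $\mathbf JS=C$. The *canonical spray* of $(M,F)$ is the unique spray $S$ with $i_Sd(dE\circ\mathbf J)=-dE$ on $\mathring{T}M$. A *geodesic*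 of $(M,F)$ is a smooth curve $\gamma\colon I\to M$ on a nondegenerate interval $I\subset\mathbb R$ whose velocity field $\dot\gamma\colon I\to TM$ is an integral curve of the canonical spray, $S\circ\dot\gamma=\ddot\gamma$. Let $(M,F)$ and $(N,\bar F)$ be (possibly different) Finsler manifolds. A *Finslerian isometry* is a diffeomorphism $\varphi\colon M\to N$ with $\bar F\circ\varphi_*=F$. A *local Finslerian isometry* is a map $\varphi\colon M\to N$ such that every point of $M$ has an open neighbourhood $U$ that $\varphi$ maps diffeomorphically onto an open subset of $N$, with $\bar F\circ\varphi_*=F$ on $TU$. **Proposition.** Let $\varphi\colon M\to N$ be a Finslerian isometry or a local Finslerian isometry. If $\gamma\colon I\to M$ is a geodesic of $(M,F)$, then $\varphi\circ\gamma\colon I\to N$ is a geodesic of $(N,\bar F)$. Moreover, the canonical sprays $S$ of $(M,F)$ and $\bar S$ of $(N,\bar F)$ satisfy $\varphi_{**}\circ S=\bar S\circ\varphi_*$ on $TM$. -/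

import Mathlib

open scoped Manifold ContDiff Topology

noncomputable section

namespace FinslerGeometry

section ExteriorDerivative

variable {V : Type*} [NormedAddCommGroup V] [NormedSpace ℝ V]
  {H : Type*} [TopologicalSpace H] (J : ModelWithCorners ℝ V H)
  {Q : Type*} [TopologicalSpace Q] [ChartedSpace H Q]

/-- The coordinate expression, in the preferred chart at `x`, of a 1-form `θ` on a manifold `Q`
without boundary: the pull-back of `θ` by the inverse of the chart. -/
def oneFormInChart (θ : ∀ y : Q, TangentSpace J y →L[ℝ] ℝ) (x : Q) (z : V) : V →L[ℝ] ℝ :=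
  (θ ((extChartAt J x).symm z)).comp (mfderiv 𝓘(ℝ, V) J (extChartAt J x).symm z)

/-- The exterior derivative `(dθ)ₓ(ξ, η)` of a 1-form `θ` on a manifold without boundary, computed
in the preferred chart at `x`, with the convention `dθ(X, Y) = X θ(Y) - Y θ(X) - θ([X, Y])`. -/
def oneFormExtDeriv (θ : ∀ y : Q, TangentSpace J y →L[ℝ] ℝ) (x : Q)
    (ξ η : TangentSpace J x) : ℝ :=
  let D := fderiv ℝ (oneFormInChart J θ x) (extChartAt J x x)
  let ξ' : V := mfderiv J 𝓘(ℝ, V) (extChartAt J x) x ξ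
  let η' : V := mfderiv J 𝓘(ℝ, V) (extChartAt J x) x η
  D ξ' η' - D η' ξ'

end ExteriorDerivative

variable {E : Type*} [NormedAddCommGroup E] [NormedSpace ℝ E]
  {M : Type*} [TopologicalSpace M] [ChartedSpace E M]

section Basic

variable (E M) in
/-- The set of nonzero tangent vectors of `M`. -/
def slit : Set (TangentBundle 𝓘(ℝ, E) M) := {v | v.2 ≠ 0}

/-- The dilation `v ↦ t v` of the tangent bundle. -/
def dilation (t : ℝ) (v : TangentBundle 𝓘(ℝ, E) M) : TangentBundle 𝓘(ℝ, E) M :=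
  ⟨v.1, t • v.2⟩

/-- The fibre inclusion `T_pM → TM`, where `T_pM` is the vector space `E`. -/
def fiberIncl (p : M) (u : E) : TangentBundle 𝓘(ℝ, E) M := ⟨p, u⟩

/-- The energy function `E = F² / 2`. -/
def energy (F : TangentBundle 𝓘(ℝ, E) M → ℝ) (v : TangentBundle 𝓘(ℝ, E) M) : ℝ :=
  (1 / 2) * F v ^ 2

/-- `F_p²` as a function on the vector space `T_pM = E`. -/
def fiberSq (F : TangentBundle 𝓘(ℝ, E) M → ℝ) (p : M) (u : E) : ℝ := F (fiberIncl p u) ^ 2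

end Basic

variable [IsManifold 𝓘(ℝ, E) ∞ M]

/-- Finsler functions: continuous on `TM`, smooth on the nonzero vectors, positive-homogeneous of
degree 1, positive on the nonzero vectors, and elliptic. -/
structure IsFinslerFunction (F : TangentBundle 𝓘(ℝ, E) M → ℝ) : Prop where
  continuous : Continuous F
  smooth : ContMDiffOn 𝓘(ℝ, E).tangent 𝓘(ℝ, ℝ) ∞ F (slit E M)
  homogeneous : ∀ (t : ℝ) (v : TangentBundle 𝓘(ℝ, E) M), 0 < t → F (dilation t v) = t * F v
  pos : ∀ v ∈ slit E M, 0 < F v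
  elliptic : ∀ (p : M) (v w : E), v ≠ 0 → w ≠ 0 →
    0 < fderiv ℝ (fderiv ℝ (fiberSq F p)) v w w

/-- The vertical lift at `v ∈ TM` of a vector of `T_{π(v)}M`: the derivative at `v` of the inclusion
of the fibre. -/
def vlift (v : TangentBundle 𝓘(ℝ, E) M) :
    TangentSpace 𝓘(ℝ, E) v.1 →L[ℝ] TangentSpace 𝓘(ℝ, E).tangent v :=
  mfderiv 𝓘(ℝ, E) 𝓘(ℝ, E).tangent (fun u : E => (fiberIncl v.1 u : TangentBundle 𝓘(ℝ, E) M))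
    (v.2 : E)

/-- The vertical endomorphism `𝐉` at `v`: project to `TM`, then lift vertically. -/
def vertEndo (v : TangentBundle 𝓘(ℝ, E) M) :
    TangentSpace 𝓘(ℝ, E).tangent v →L[ℝ] TangentSpace 𝓘(ℝ, E).tangent v :=
  (vlift v).comp (mfderiv 𝓘(ℝ, E).tangent 𝓘(ℝ, E)
    (fun w : TangentBundle 𝓘(ℝ, E) M => w.1) v)

/-- The Liouville vector field `C`. -/
def liouville (v : TangentBundle 𝓘(ℝ, E) M) : TangentSpace 𝓘(ℝ, E).tangent v := vlift v v.2

/-- The differential of a real function on `TM`. -/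
def diff (f : TangentBundle 𝓘(ℝ, E) M → ℝ) (v : TangentBundle 𝓘(ℝ, E) M) :
    TangentSpace 𝓘(ℝ, E).tangent v →L[ℝ] ℝ :=
  mfderiv 𝓘(ℝ, E).tangent 𝓘(ℝ, ℝ) f v

/-- Sprays: sections of `TTM → TM`, smooth on the nonzero vectors, positive-homogeneous of
degree 2, with `𝐉 S = C`. -/
structure IsSpray
    (S : ∀ v : TangentBundle 𝓘(ℝ, E) M, TangentSpace 𝓘(ℝ, E).tangent v) : Prop where
  smooth : ContMDiffOn 𝓘(ℝ, E).tangent 𝓘(ℝ, E).tangent.tangent ∞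
    (fun v => (⟨v, S v⟩ : TangentBundle 𝓘(ℝ, E).tangent (TangentBundle 𝓘(ℝ, E) M))) (slit E M)
  homogeneous : ∀ (t : ℝ) (v : TangentBundle 𝓘(ℝ, E) M), 0 < t →
    S (dilation t v) =
      t • mfderiv 𝓘(ℝ, E).tangent 𝓘(ℝ, E).tangent (dilation (M := M) t) v (S v)
  vertEndo_eq : ∀ v, vertEndo v (S v) = liouville v

/-- `S` is the canonical spray of `F`: it is a spray and `i_S d(dE ∘ 𝐉) = -dE` on the nonzero
vectors, where `E` is the energy. -/
structure IsCanonicalSpray (F : TangentBundle 𝓘(ℝ, E) M → ℝ)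
    (S : ∀ v : TangentBundle 𝓘(ℝ, E) M, TangentSpace 𝓘(ℝ, E).tangent v) : Prop where
  isSpray : IsSpray S
  eq : ∀ v ∈ slit E M, ∀ η : TangentSpace 𝓘(ℝ, E).tangent v,
    oneFormExtDeriv 𝓘(ℝ, E).tangent (fun w => (diff (energy F) w).comp (vertEndo w)) v (S v) η
      = - diff (energy F) v η

/-- The velocity field of a curve `γ` defined on an interval `s` (with one-sided derivatives at end
points that belong to `s`). -/
def velocity (γ : ℝ → M) (s : Set ℝ) (t : ℝ) : TangentBundle 𝓘(ℝ, E) M :=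
  ⟨γ t, mfderivWithin 𝓘(ℝ, ℝ) 𝓘(ℝ, E) γ s t (1 : ℝ)⟩

/-- `γ : s → M` is a geodesic of the spray `S`: it is smooth and its velocity field is an integral
curve of `S`. The values of `γ` outside `s` are irrelevant. -/
def IsSprayGeodesic (S : ∀ v : TangentBundle 𝓘(ℝ, E) M, TangentSpace 𝓘(ℝ, E).tangent v)
    (γ : ℝ → M) (s : Set ℝ) : Prop :=
  ContMDiffOn 𝓘(ℝ, ℝ) 𝓘(ℝ, E) ∞ γ s ∧ IsMIntegralCurveOn (velocity γ s) S s

/-- `γ : s → M` is a geodesic of the Finsler function `F`: it is a geodesic of the canonical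
spray. -/
def IsFinslerGeodesic (F : TangentBundle 𝓘(ℝ, E) M → ℝ) (γ : ℝ → M) (s : Set ℝ) : Prop :=
  ∃ S, IsCanonicalSpray F S ∧ IsSprayGeodesic S γ s

variable {E' : Type*} [NormedAddCommGroup E'] [NormedSpace ℝ E']
  {N : Type*} [TopologicalSpace N] [ChartedSpace E' N] [IsManifold 𝓘(ℝ, E') ∞ N]

/-- Finslerian isometries: diffeomorphisms whose derivative preserves the Finsler functions. -/
def IsFinslerIsometry (F : TangentBundle 𝓘(ℝ, E) M → ℝ) (F' : TangentBundle 𝓘(ℝ, E') N → ℝ)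
    (φ : M → N) : Prop :=
  (∃ Φ : M ≃ₘ^∞⟮𝓘(ℝ, E), 𝓘(ℝ, E')⟯ N, φ = Φ) ∧
    ∀ v, F' (tangentMap 𝓘(ℝ, E) 𝓘(ℝ, E') φ v) = F v

/-- Local Finslerian isometries: every point has an open neighbourhood that `φ` maps
diffeomorphically onto an open set, with the derivative preserving the Finsler functions. -/
def IsLocalFinslerIsometry (F : TangentBundle 𝓘(ℝ, E) M → ℝ)
    (F' : TangentBundle 𝓘(ℝ, E') N → ℝ) (φ : M → N) : Prop :=
  ∀ p : M, ∃ Φ : PartialDiffeomorph 𝓘(ℝ, E) 𝓘(ℝ, E') M N ∞,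
    p ∈ Φ.source ∧ Set.EqOn φ Φ Φ.source ∧
      ∀ v : TangentBundle 𝓘(ℝ, E) M, v.1 ∈ Φ.source →
        F' (tangentMap 𝓘(ℝ, E) 𝓘(ℝ, E') φ v) = F v

end FinslerGeometry

end

/-!
The canonical spray is the solution of `i_S dθ = -dE`, where `θ = dE ∘ 𝐉` is the Cartan form.
If `g v = t φ_* v`, then `Dg ∘ 𝐉 = t 𝐉 ∘ Dg`, so `E' ∘ g = t² E` implies `g^*θ' = t θ`, and hence
`t Dg` carries solutions of the equation for `E` to solutions of the equation for `E'`. Ellipticity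
makes `dθ` nondegenerate on nonzero vectors, so solutions there are unique. For `t = 1` and a local
isometry `φ` this gives `φ_{**} ∘ S = S' ∘ φ_*`; for `φ = id` it gives the homogeneity of the
solution and, with Euler's identity for `𝐉 S = C`, the existence of the canonical spray. Geodesics
are then mapped to geodesics by the chain rule.
-/

noncomputable section

namespace FinslerGeometry

section Homogeneous

variable {V W : Type*} [NormedAddCommGroup V] [NormedSpace ℝ V]
  [NormedAddCommGroup W] [NormedSpace ℝ W]

lemma fderiv_apply_self_of_homogeneous {f : V → W} {k : ℕ} {u : V}
    (hf : DifferentiableAt ℝ f u) (hom : ∀ t : ℝ, 0 < t → f (t • u) = t ^ k • f u) :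
    fderiv ℝ f u u = (k : ℝ) • f u := by
  have hray : HasDerivAt (fun t : ℝ => t • u) u 1 := by
    simpa using (hasDerivAt_id (1 : ℝ)).smul_const u
  have hleft : HasDerivAt (fun t : ℝ => f (t • u)) (fderiv ℝ f u u) 1 :=
    HasFDerivAt.comp_hasDerivAt (1 : ℝ) (by simpa using hf.hasFDerivAt) hray
  have hright : HasDerivAt (fun t : ℝ => t ^ k • f u) ((k : ℝ) • f u) 1 := by
    simpa using (hasDerivAt_pow k (1 : ℝ)).smul_const (f u)
  refine hleft.unique (hright.congr_of_eventuallyEq ?_)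
  filter_upwards [lt_mem_nhds one_pos] with t ht using hom t ht

lemma fderiv_homogeneous {f : V → W} {k : ℕ}
    (hom : ∀ (t : ℝ) (u : V), 0 < t → f (t • u) = t ^ (k + 1) • f u) {t : ℝ} (ht : 0 < t)
    (u : V) : fderiv ℝ f (t • u) = t ^ k • fderiv ℝ f u := by
  have h : t • fderiv ℝ f (t • u) = t • t ^ k • fderiv ℝ f u := by
    rw [← fderiv_comp_smul, funext fun w => hom t w ht, smul_smul, ← pow_succ']
    exact congrFun (fderiv_const_smul_field (t ^ (k + 1))) u
  exact smul_right_injective _ ht.ne' h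

lemma fderiv_fderiv_apply_self_of_homogeneous {f : V → ℝ} {y : V} (hf : ContDiffAt ℝ 2 f y)
    (hom : ∀ (t : ℝ) (u : V), 0 < t → f (t • u) = t ^ 2 • f u) (b : V) :
    fderiv ℝ (fderiv ℝ f) y b y = fderiv ℝ f y b := by
  have hd : DifferentiableAt ℝ (fderiv ℝ f) y :=
    (hf.fderiv_right (m := 1) le_rfl).differentiableAt one_ne_zero
  have heuler := fderiv_apply_self_of_homogeneous hd fun t ht => fderiv_homogeneous hom ht y
  have hsymm : IsSymmSndFDerivAt ℝ f y := hf.isSymmSndFDerivAt (by simp)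
  rw [hsymm.eq, heuler, Nat.cast_one, one_smul]

end Homogeneous

section ExteriorDerivative

variable {V V' : Type*} [NormedAddCommGroup V] [NormedSpace ℝ V]
  [NormedAddCommGroup V'] [NormedSpace ℝ V']

/-- The exterior derivative at `z` of a 1-form `θ` on a normed space, as a bilinear form. -/
def extDerivBilin (θ : V → V →L[ℝ] ℝ) (z : V) : V →L[ℝ] V →L[ℝ] ℝ :=
  fderiv ℝ θ z - (fderiv ℝ θ z).flip

lemma extDerivBilin_apply (θ : V → V →L[ℝ] ℝ) (z ξ η : V) :
    extDerivBilin θ z ξ η = fderiv ℝ θ z ξ η - fderiv ℝ θ z η ξ :=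
  rfl

lemma contDiffAt_extDerivBilin {θ : V → V →L[ℝ] ℝ} {z : V} {m n : WithTop ℕ∞}
    (hθ : ContDiffAt ℝ n θ z) (hmn : m + 1 ≤ n) : ContDiffAt ℝ m (extDerivBilin θ) z :=
  have hD : ContDiffAt ℝ m (fderiv ℝ θ) z := hθ.fderiv_right hmn
  have hflip : ContDiff ℝ m fun B : V →L[ℝ] V →L[ℝ] ℝ => B.flip :=
    LinearIsometryEquiv.contDiff (𝕜 := ℝ) (E := V →L[ℝ] V →L[ℝ] ℝ) (F := V →L[ℝ] V →L[ℝ] ℝ)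
      (ContinuousLinearMap.flipₗᵢ ℝ V V ℝ)
  hD.sub (hflip.contDiffAt.comp z hD)

lemma extDerivBilin_pullback {θ : V' → V' →L[ℝ] ℝ} {g : V → V'} {z : V}
    (hθ : DifferentiableAt ℝ θ (g z)) (hg : ContDiffAt ℝ 2 g z) (ξ η : V) :
    extDerivBilin (fun w => (θ (g w)).comp (fderiv ℝ g w)) z ξ η =
      extDerivBilin θ (g z) (fderiv ℝ g z ξ) (fderiv ℝ g z η) := by
  have hDg : DifferentiableAt ℝ (fderiv ℝ g) z :=
    (hg.fderiv_right (m := 1) le_rfl).differentiableAt one_ne_zero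
  have hcomp := hθ.hasFDerivAt.comp z (hg.differentiableAt two_ne_zero).hasFDerivAt
  have hsymm : IsSymmSndFDerivAt ℝ g z := hg.isSymmSndFDerivAt (by simp)
  have hpull := (hcomp.clm_comp hDg.hasFDerivAt).fderiv
  simp only [Function.comp_def] at hpull
  rw [extDerivBilin_apply, extDerivBilin_apply, hpull]
  simp [hsymm.eq ξ η]

lemma isInvertible_of_injective_dual [FiniteDimensional ℝ V] {B : V →L[ℝ] V →L[ℝ] ℝ}
    (hB : Function.Injective B) : B.IsInvertible := by
  have hdim : Module.finrank ℝ V = Module.finrank ℝ (V →L[ℝ] ℝ) := by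
    rw [← (LinearMap.toContinuousLinearMap (𝕜 := ℝ) (E := V) (F' := ℝ)).finrank_eq]
    exact Subspace.dual_finrank_eq.symm
  exact ⟨(LinearEquiv.ofInjectiveOfFinrankEq B.toLinearMap hB hdim).toContinuousLinearEquiv,
    rfl⟩

end ExteriorDerivative

section VerticalForm

variable {E : Type*} [NormedAddCommGroup E] [NormedSpace ℝ E] {L : E × E → ℝ} {z : E × E}

/-- The 1-form `dL ∘ 𝐉` on `E × E`, where `𝐉 (a, b) = (0, a)` is the vertical endomorphism. -/
def vertForm (L : E × E → ℝ) (z : E × E) : E × E →L[ℝ] ℝ :=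
  (fderiv ℝ L z).comp ((ContinuousLinearMap.inr ℝ E E).comp (ContinuousLinearMap.fst ℝ E E))

lemma contDiffAt_vertForm {m n : WithTop ℕ∞} (hL : ContDiffAt ℝ n L z) (hmn : m + 1 ≤ n) :
    ContDiffAt ℝ m (vertForm L) z :=
  (hL.fderiv_right hmn).clm_comp contDiffAt_const

lemma extDerivBilin_vertForm (hL : ContDiffAt ℝ 2 L z) (ξ η : E × E) :
    extDerivBilin (vertForm L) z ξ η =
      fderiv ℝ (fderiv ℝ L) z ξ (0, η.1) - fderiv ℝ (fderiv ℝ L) z η (0, ξ.1) := by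
  have hd : DifferentiableAt ℝ (fderiv ℝ L) z :=
    (hL.fderiv_right (m := 1) le_rfl).differentiableAt one_ne_zero
  have hvert := (hd.hasFDerivAt.clm_comp (hasFDerivAt_const
    ((ContinuousLinearMap.inr ℝ E E).comp (ContinuousLinearMap.fst ℝ E E)) z)).fderiv
  rw [extDerivBilin_apply, show vertForm L = fun w => (fderiv ℝ L w).comp _ from rfl, hvert]
  simp

lemma injective_extDerivBilin_vertForm (hL : ContDiffAt ℝ 2 L z)
    (hpos : ∀ b : E, b ≠ 0 → 0 < fderiv ℝ (fderiv ℝ L) z (0, b) (0, b)) :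
    Function.Injective (extDerivBilin (vertForm L) z) := by
  refine (injective_iff_map_eq_zero _).2 fun ξ hξ => ?_
  have hω (η : E × E) :
      fderiv ℝ (fderiv ℝ L) z ξ (0, η.1) = fderiv ℝ (fderiv ℝ L) z η (0, ξ.1) := by
    rw [← sub_eq_zero, ← extDerivBilin_vertForm hL, hξ, zero_apply]
  have hfst : ξ.1 = 0 := by
    by_contra hne
    exact (hpos ξ.1 hne).ne' (by simpa [Prod.mk_zero_zero] using (hω (0, ξ.1)).symm)
  have hvert : ξ = (0, ξ.2) := Prod.ext hfst rfl
  have hsnd : ξ.2 = 0 := by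
    by_contra hne
    have h : fderiv ℝ (fderiv ℝ L) z ξ (0, ξ.2) = 0 := by
      simpa [hfst, Prod.mk_zero_zero] using hω (ξ.2, 0)
    exact (hpos ξ.2 hne).ne' (by rwa [hvert] at h)
  exact Prod.ext hfst hsnd

lemma fst_eq_of_extDerivBilin_vertForm (hL : ContDiffAt ℝ 2 L z)
    (hpos : ∀ b : E, b ≠ 0 → 0 < fderiv ℝ (fderiv ℝ L) z (0, b) (0, b))
    (heuler : ∀ b : E, fderiv ℝ (fderiv ℝ L) z (0, b) (0, z.2) = fderiv ℝ L z (0, b))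
    {ξ : E × E} (hξ : extDerivBilin (vertForm L) z ξ = -fderiv ℝ L z) : ξ.1 = z.2 := by
  have hω (b : E) : fderiv ℝ (fderiv ℝ L) z (0, b) (0, ξ.1 - z.2) = 0 := by
    have hb := congrArg (· (0, b)) hξ
    simp only [extDerivBilin_vertForm hL, neg_apply, ← heuler, Prod.mk_zero_zero, map_zero,
      zero_sub, neg_inj] at hb
    rw [← sub_zero (0 : E), ← Prod.mk_sub_mk, map_sub, sub_zero, hb, sub_self]
  exact sub_eq_zero.1 (not_not.1 fun hne => (hpos _ hne).ne' (hω _))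

lemma fderiv_comp_prodMk_left {x y : E} (hL : DifferentiableAt ℝ L (x, y)) (b : E) :
    fderiv ℝ (fun u => L (x, u)) y b = fderiv ℝ L (x, y) (0, b) := by
  have h := hL.hasFDerivAt.comp y (hasFDerivAt_prodMk_right x y)
  simp only [Function.comp_def] at h
  rw [h.fderiv]
  simp

lemma fderiv_fderiv_comp_prodMk_left {x y : E} (hL : ContDiffAt ℝ 2 L (x, y)) (b a : E) :
    fderiv ℝ (fderiv ℝ fun u => L (x, u)) y b a =
      fderiv ℝ (fderiv ℝ L) (x, y) (0, b) (0, a) := by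
  have hd : DifferentiableAt ℝ (fderiv ℝ L) (x, y) :=
    (hL.fderiv_right (m := 1) le_rfl).differentiableAt one_ne_zero
  have hslice : fderiv ℝ (fun u => L (x, u)) =ᶠ[𝓝 y]
      fun u => (fderiv ℝ L (x, u)).comp (ContinuousLinearMap.inr ℝ E E) := by
    have hc : ContinuousAt (fun u : E => (x, u)) y := by fun_prop
    filter_upwards [hc.eventually (hL.eventually (by simp))] with u hu
    ext a
    simpa using fderiv_comp_prodMk_left (hu.differentiableAt two_ne_zero) a
  have h := (hd.hasFDerivAt.comp y (hasFDerivAt_prodMk_right x y)).clm_comp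
    (hasFDerivAt_const (ContinuousLinearMap.inr ℝ E E) y)
  simp only [Function.comp_def] at h
  rw [hslice.fderiv_eq, h.fderiv]
  simp

end VerticalForm

section OneForms

variable {V : Type*} [NormedAddCommGroup V] [NormedSpace ℝ V] {H : Type*} [TopologicalSpace H]
  {J : ModelWithCorners ℝ V H} {Q : Type*} [TopologicalSpace Q] [ChartedSpace H Q]
  {V' : Type*} [NormedAddCommGroup V'] [NormedSpace ℝ V'] {H' : Type*} [TopologicalSpace H']
  {J' : ModelWithCorners ℝ V' H'} {Q' : Type*} [TopologicalSpace Q'] [ChartedSpace H' Q']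
  {V'' : Type*} [NormedAddCommGroup V''] [NormedSpace ℝ V''] {H'' : Type*} [TopologicalSpace H'']
  {J'' : ModelWithCorners ℝ V'' H''} {Q'' : Type*} [TopologicalSpace Q''] [ChartedSpace H'' Q'']

variable (J J') in
/-- The pull-back `g^*θ` of a 1-form along a map of manifolds. -/
def oneFormPullback (g : Q → Q') (θ : ∀ y : Q', TangentSpace J' y →L[ℝ] ℝ) (x : Q) :
    TangentSpace J x →L[ℝ] ℝ :=
  (θ (g x)).comp (mfderiv J J' g x)

lemma oneFormPullback_congr {g₁ g₂ : Q → Q'} {x : Q} (h : g₁ =ᶠ[𝓝 x] g₂)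
    (θ : ∀ y : Q', TangentSpace J' y →L[ℝ] ℝ) :
    oneFormPullback J J' g₁ θ x = oneFormPullback J J' g₂ θ x := by
  rw [oneFormPullback, oneFormPullback, h.mfderiv_eq, h.self_of_nhds]

lemma oneFormPullback_comp {g : Q' → Q''} {f : Q → Q'} {x : Q}
    (hg : MDifferentiableAt J' J'' g (f x)) (hf : MDifferentiableAt J J' f x)
    (θ : ∀ y : Q'', TangentSpace J'' y →L[ℝ] ℝ) :
    oneFormPullback J J'' (g ∘ f) θ x =
      oneFormPullback J J' f (oneFormPullback J' J'' g θ) x := by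
  rw [oneFormPullback, mfderiv_comp x hg hf]
  rfl

lemma oneFormInChart_eq_oneFormPullback (θ : ∀ y : Q, TangentSpace J y →L[ℝ] ℝ) (x : Q) :
    oneFormInChart J θ x = oneFormPullback 𝓘(ℝ, V) J (extChartAt J x).symm θ :=
  rfl

lemma oneFormExtDeriv_const_smul (c : ℝ) (θ : ∀ y : Q, TangentSpace J y →L[ℝ] ℝ) (x : Q)
    (ξ η : TangentSpace J x) :
    oneFormExtDeriv J (fun y => c • θ y) x ξ η = c * oneFormExtDeriv J θ x ξ η := by
  have hD : fderiv ℝ (oneFormInChart J (fun y => c • θ y) x) (extChartAt J x x) =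
      c • fderiv ℝ (oneFormInChart J θ x) (extChartAt J x x) :=
    congrFun (fderiv_const_smul_field (f := oneFormInChart J θ x) c) _
  simp only [oneFormExtDeriv, hD]
  exact (mul_sub c _ _).symm

lemma oneFormExtDeriv_congr {θ₁ θ₂ : ∀ y : Q, TangentSpace J y →L[ℝ] ℝ} {x : Q}
    (h : ∀ᶠ y in 𝓝 x, θ₁ y = θ₂ y) (ξ η : TangentSpace J x) :
    oneFormExtDeriv J θ₁ x ξ η = oneFormExtDeriv J θ₂ x ξ η := by
  have hc : Filter.Tendsto (extChartAt J x).symm (𝓝 (extChartAt J x x)) (𝓝 x) := by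
    simpa using (continuousAt_extChartAt_symm (I := J) x).tendsto
  have hchart : oneFormInChart J θ₁ x =ᶠ[𝓝 (extChartAt J x x)] oneFormInChart J θ₂ x := by
    filter_upwards [hc.eventually h] with z hz
    rw [oneFormInChart, oneFormInChart, hz]
  simp only [oneFormExtDeriv, hchart.fderiv_eq]

lemma oneFormInChart_model (θ : ∀ y : V, TangentSpace 𝓘(ℝ, V) y →L[ℝ] ℝ) (z : V) :
    oneFormInChart 𝓘(ℝ, V) θ z = θ := by
  funext w
  have hw : mfderiv 𝓘(ℝ, V) 𝓘(ℝ, V) (extChartAt 𝓘(ℝ, V) z).symm w = .id ℝ V := by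
    rw [extChartAt_model_space_eq_id]
    exact mfderiv_id
  rw [oneFormInChart, hw, extChartAt_model_space_eq_id]
  exact ContinuousLinearMap.comp_id _

lemma oneFormExtDeriv_eq_extDerivBilin [IsManifold J 1 Q] (θ : ∀ y : Q, TangentSpace J y →L[ℝ] ℝ)
    (x : Q) (ξ η : V) : oneFormExtDeriv J θ x ξ η =
      extDerivBilin (oneFormInChart J θ x) (extChartAt J x x) ξ η := by
  have hid (ζ : V) : (mfderiv J 𝓘(ℝ, V) (extChartAt J x) x ζ : V) = ζ :=
    DFunLike.congr_fun (mfderiv_extChartAt_self (I := J) (x := x)) ζ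
  exact congrArg₂ (fun a b : V => extDerivBilin (oneFormInChart J θ x) (extChartAt J x x) a b)
    (hid ξ) (hid η)

lemma oneFormExtDeriv_smul_left [IsManifold J 1 Q] (c : ℝ)
    (θ : ∀ y : Q, TangentSpace J y →L[ℝ] ℝ) (x : Q) (ξ η : TangentSpace J x) :
    oneFormExtDeriv J θ x (c • ξ) η = c * oneFormExtDeriv J θ x ξ η := by
  have hsmul := DFunLike.congr_fun (map_smul
    (extDerivBilin (oneFormInChart J θ x) (extChartAt J x x)) c (ξ : V)) (η : V)
  exact (oneFormExtDeriv_eq_extDerivBilin θ x _ η).trans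
    (hsmul.trans (congrArg (c * ·) (oneFormExtDeriv_eq_extDerivBilin θ x ξ η).symm))

lemma contMDiffAt_extChartAt_symm [J.Boundaryless] {n : WithTop ℕ∞} [IsManifold J n Q] {x : Q}
    {z : V} (hz : z ∈ (extChartAt J x).target) :
    ContMDiffAt 𝓘(ℝ, V) J n (extChartAt J x).symm z :=
  (contMDiffOn_extChartAt_symm x).contMDiffAt ((isOpen_extChartAt_target x).mem_nhds hz)

lemma oneFormInChart_oneFormPullback [J.Boundaryless] [J'.Boundaryless]
    [IsManifold J 1 Q] [IsManifold J' 1 Q'] {g : Q → Q'} {x : Q} {x' : Q'} {z : V}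
    (hz : z ∈ (extChartAt J x).target)
    (hg : MDifferentiableAt J J' g ((extChartAt J x).symm z))
    (hgz : g ((extChartAt J x).symm z) ∈ (extChartAt J' x').source)
    (θ : ∀ y : Q', TangentSpace J' y →L[ℝ] ℝ) :
    oneFormInChart J (oneFormPullback J J' g θ) x z =
      oneFormPullback 𝓘(ℝ, V) 𝓘(ℝ, V') (extChartAt J' x' ∘ g ∘ (extChartAt J x).symm)
        (oneFormInChart J' θ x') z := by
  have hψ : MDifferentiableAt 𝓘(ℝ, V) J (extChartAt J x).symm z :=
    (contMDiffAt_extChartAt_symm hz).mdifferentiableAt one_ne_zero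
  have hψ' : MDifferentiableAt 𝓘(ℝ, V') J' (extChartAt J' x').symm
      ((extChartAt J' x' ∘ g ∘ (extChartAt J x).symm) z) :=
    (contMDiffAt_extChartAt_symm ((extChartAt J' x').map_source hgz)).mdifferentiableAt one_ne_zero
  have hrep : MDifferentiableAt 𝓘(ℝ, V) 𝓘(ℝ, V')
      (extChartAt J' x' ∘ g ∘ (extChartAt J x).symm) z :=
    (mdifferentiableAt_extChartAt (by rwa [← extChartAt_source J'])).comp z (hg.comp z hψ)
  have hfactor : g ∘ (extChartAt J x).symm =ᶠ[𝓝 z]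
      (extChartAt J' x').symm ∘ extChartAt J' x' ∘ g ∘ (extChartAt J x).symm := by
    filter_upwards [(hg.comp z hψ).continuousAt
      ((isOpen_extChartAt_source x').mem_nhds hgz)] with w hw
    exact ((extChartAt J' x').left_inv hw).symm
  rw [oneFormInChart_eq_oneFormPullback, ← oneFormPullback_comp hg hψ,
    oneFormPullback_congr hfactor]
  exact oneFormPullback_comp hψ' hrep θ

lemma oneFormExtDeriv_oneFormPullback [J.Boundaryless] [J'.Boundaryless]
    [IsManifold J 2 Q] [IsManifold J' 2 Q'] {g : Q → Q'} {x : Q} (hg : ContMDiffAt J J' 2 g x)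
    {θ : ∀ y : Q', TangentSpace J' y →L[ℝ] ℝ}
    (hθ : DifferentiableAt ℝ (oneFormInChart J' θ (g x)) (extChartAt J' (g x) (g x)))
    (ξ η : TangentSpace J x) :
    oneFormExtDeriv J (oneFormPullback J J' g θ) x ξ η =
      oneFormExtDeriv J' θ (g x) (mfderiv J J' g x ξ) (mfderiv J J' g x η) := by
  have : IsManifold J 1 Q := .of_le one_le_two
  have : IsManifold J' 1 Q' := .of_le one_le_two
  set z := extChartAt J x x with hz
  set G := extChartAt J' (g x) ∘ g ∘ (extChartAt J x).symm with hG
  have hGz : G z = extChartAt J' (g x) (g x) := by simp [hG, hz]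
  have hGsmooth : ContDiffAt ℝ 2 G z := by
    rw [← contDiffWithinAt_univ, ← J.range_eq_univ]
    exact (contMDiffAt_iff.1 hg).2
  have hDG : fderiv ℝ G z = mfderiv J J' g x := by
    rw [(hg.mdifferentiableAt two_ne_zero).mfderiv, writtenInExtChartAt, J.range_eq_univ,
      fderivWithin_univ]
  have hchart : oneFormInChart J (oneFormPullback J J' g θ) x =ᶠ[𝓝 z]
      fun w => (oneFormInChart J' θ (g x) (G w)).comp (fderiv ℝ G w) := by
    have hsymm : Filter.Tendsto (extChartAt J x).symm (𝓝 z) (𝓝 x) := by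
      simpa [hz] using (continuousAt_extChartAt_symm (I := J) x).tendsto
    have hnear := (contMDiffAt_iff_contMDiffAt_nhds (by simp)).1 hg
    filter_upwards [extChartAt_target_mem_nhds x, hsymm.eventually hnear,
      hsymm.eventually (hg.continuousAt (extChartAt_source_mem_nhds (I := J') (g x)))]
      with w hw hgw hsource
    exact (oneFormInChart_oneFormPullback hw (hgw.mdifferentiableAt two_ne_zero) hsource θ).trans
      (congrArg (oneFormInChart J' θ (g x) (G w)).comp mfderiv_eq_fderiv)
  rw [← hGz] at hθ
  have hpull := extDerivBilin_pullback (V := V) hθ hGsmooth ξ η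
  rw [extDerivBilin, ← hchart.fderiv_eq, ← extDerivBilin, hDG, hGz] at hpull
  exact (oneFormExtDeriv_eq_extDerivBilin (J := J) _ x ξ η).trans
    (hpull.trans (oneFormExtDeriv_eq_extDerivBilin θ (g x) _ _).symm)

lemma oneFormPullback_extChartAt_oneFormInChart [J.Boundaryless] [IsManifold J 1 Q] {x w : Q}
    (hw : w ∈ (extChartAt J x).source) (θ : ∀ y : Q, TangentSpace J y →L[ℝ] ℝ) :
    oneFormPullback J 𝓘(ℝ, V) (extChartAt J x) (oneFormInChart J θ x) w = θ w := by
  have hinv : (extChartAt J x).symm ∘ extChartAt J x =ᶠ[𝓝 w] id := by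
    filter_upwards [(isOpen_extChartAt_source x).mem_nhds hw] with y hy
    exact (extChartAt J x).left_inv hy
  have hcomp := oneFormPullback_comp (J := J) (x := w) (f := extChartAt J x)
    (g := (extChartAt J x).symm)
    ((contMDiffAt_extChartAt_symm ((extChartAt J x).map_source hw)).mdifferentiableAt one_ne_zero)
    (mdifferentiableAt_extChartAt (by rwa [← extChartAt_source J])) θ
  rw [oneFormPullback_congr hinv, oneFormPullback, mfderiv_id] at hcomp
  exact hcomp.symm

lemma oneFormInChart_extChartAt_self [J.Boundaryless] [IsManifold J 1 Q]
    (θ : ∀ y : Q, TangentSpace J y →L[ℝ] ℝ) (x : Q) :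
    oneFormInChart J θ x (extChartAt J x x) = θ x :=
  have hid := congrArg (fun A : V →L[ℝ] V => (oneFormInChart J θ x (extChartAt J x x)).comp A)
    (mfderiv_extChartAt_self (I := J) (x := x))
  hid.symm.trans (oneFormPullback_extChartAt_oneFormInChart (mem_extChartAt_source x) θ)

lemma oneFormExtDeriv_eq_of_mem_source [J.Boundaryless] [IsManifold J 2 Q]
    {θ : ∀ y : Q, TangentSpace J y →L[ℝ] ℝ} {x w : Q} (hw : w ∈ (extChartAt J x).source)
    (hθ : DifferentiableAt ℝ (oneFormInChart J θ x) (extChartAt J x w)) (ξ η : TangentSpace J w) :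
    oneFormExtDeriv J θ w ξ η = extDerivBilin (oneFormInChart J θ x) (extChartAt J x w)
      (mfderiv J 𝓘(ℝ, V) (extChartAt J x) w ξ) (mfderiv J 𝓘(ℝ, V) (extChartAt J x) w η) := by
  have : IsManifold J 1 Q := .of_le one_le_two
  have hform : ∀ᶠ y in 𝓝 w,
      θ y = oneFormPullback J 𝓘(ℝ, V) (extChartAt J x) (oneFormInChart J θ x) y := by
    filter_upwards [(isOpen_extChartAt_source x).mem_nhds hw] with y hy
    exact (oneFormPullback_extChartAt_oneFormInChart hy θ).symm
  have hψ : ContMDiffAt J 𝓘(ℝ, V) 2 (extChartAt J x) w :=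
    contMDiffAt_extChartAt' (by rwa [← extChartAt_source J])
  have hmodel := oneFormInChart_model (oneFormInChart J θ x) (extChartAt J x w)
  rw [oneFormExtDeriv_congr hform]
  refine (oneFormExtDeriv_oneFormPullback hψ (by rwa [hmodel]) ξ η).trans ?_
  refine (oneFormExtDeriv_eq_extDerivBilin _ _ _ _).trans ?_
  rw [hmodel]
  rfl

lemma trivializationAt_tangentSpace_apply [IsManifold J 1 Q] {x y : Q}
    (hy : y ∈ (extChartAt J x).source) (ξ : TangentSpace J y) :
    (trivializationAt V (TangentSpace J) x ⟨y, ξ⟩).2 =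
      mfderiv J 𝓘(ℝ, V) (extChartAt J x) y ξ := by
  have hsource : y ∈ (chartAt H x).source := by rwa [← extChartAt_source J]
  rw [← TangentBundle.continuousLinearMapAt_trivializationAt hsource]
  exact (Bundle.Trivialization.continuousLinearMapAt_apply_of_mem ℝ
    (trivializationAt V (TangentSpace J) x) hsource ξ).symm

lemma extDerivBilin_mfderiv_extChartAt_eq [J.Boundaryless] [IsManifold J 2 Q]
    {θ α : ∀ y : Q, TangentSpace J y →L[ℝ] ℝ} {x y : Q} (hy : y ∈ (extChartAt J x).source)
    (hθ : DifferentiableAt ℝ (oneFormInChart J θ x) (extChartAt J x y)) {ξ : TangentSpace J y}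
    (hξ : ∀ η, oneFormExtDeriv J θ y ξ η = α y η) :
    extDerivBilin (oneFormInChart J θ x) (extChartAt J x y)
        (mfderiv J 𝓘(ℝ, V) (extChartAt J x) y ξ) =
      oneFormInChart J α x (extChartAt J x y) := by
  have : IsManifold J 1 Q := .of_le one_le_two
  ext b
  obtain ⟨η, rfl⟩ := (isInvertible_mfderiv_extChartAt hy).surjective b
  refine (oneFormExtDeriv_eq_of_mem_source hy hθ ξ η).symm.trans ((hξ η).trans ?_)
  exact (DFunLike.congr_fun (oneFormPullback_extChartAt_oneFormInChart hy α) η).symm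

/-- In a chart, `X` is obtained from the form `α` by inverting the bilinear form `dθ`. -/
lemma contMDiffAt_of_oneFormExtDeriv_eq [CompleteSpace V] [J.Boundaryless] [IsManifold J ∞ Q]
    {θ α : ∀ y : Q, TangentSpace J y →L[ℝ] ℝ} {X : ∀ y : Q, TangentSpace J y} {x : Q}
    (hθ : ContDiffAt ℝ ∞ (oneFormInChart J θ x) (extChartAt J x x))
    (hα : ContDiffAt ℝ ∞ (oneFormInChart J α x) (extChartAt J x x))
    (hω : (extDerivBilin (oneFormInChart J θ x) (extChartAt J x x)).IsInvertible)
    (hX : ∀ᶠ y in 𝓝 x, ∀ η, oneFormExtDeriv J θ y (X y) η = α y η) :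
    ContMDiffAt J J.tangent ∞ (fun y => (⟨y, X y⟩ : TangentBundle J Q)) x := by
  have hdω : ContDiffAt ℝ ∞ (extDerivBilin (oneFormInChart J θ x)) (extChartAt J x x) :=
    contDiffAt_extDerivBilin hθ (by simp)
  have hψ : ContMDiffAt J 𝓘(ℝ, V) ∞ (extChartAt J x) x := contMDiffAt_extChartAt
  have hsol : ContDiffAt ℝ ∞ (fun z => (extDerivBilin (oneFormInChart J θ x) z).inverse
      (oneFormInChart J α x z)) (extChartAt J x x) :=
    (hω.contDiffAt_map_inverse.comp _ hdω).clm_apply hα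
  have hinv : ∀ᶠ z in 𝓝 (extChartAt J x x),
      (extDerivBilin (oneFormInChart J θ x) z).IsInvertible := by
    obtain ⟨e, he⟩ := hω
    exact hdω.continuousAt.eventually (he ▸ ContinuousLinearEquiv.nhds e)
  have hdiff : ∀ᶠ z in 𝓝 (extChartAt J x x), DifferentiableAt ℝ (oneFormInChart J θ x) z :=
    ((hθ.of_le (m := 1) (by simp)).eventually (by simp)).mono
      fun z hz => hz.differentiableAt one_ne_zero
  refine (Bundle.contMDiffAt_section x).2 ?_
  refine (hsol.contMDiffAt.comp x hψ).congr_of_eventuallyEq ?_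
  filter_upwards [extChartAt_source_mem_nhds (I := J) x, hX,
    hψ.continuousAt.eventually hinv, hψ.continuousAt.eventually hdiff] with y hy hXy hyω hyθ
  rw [trivializationAt_tangentSpace_apply hy]
  exact (hyω.inverse_apply_eq.2 (extDerivBilin_mfderiv_extChartAt_eq hy hyθ hXy).symm).symm

end OneForms

section TangentBundle

variable {E : Type*} [NormedAddCommGroup E] [NormedSpace ℝ E]
  {M : Type*} [TopologicalSpace M] [ChartedSpace E M] [IsManifold 𝓘(ℝ, E) ∞ M]

/-- The preferred chart of the tangent bundle at `v`, with values in `E × E`. -/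
abbrev tangentChart (v : TangentBundle 𝓘(ℝ, E) M) :
    PartialEquiv (TangentBundle 𝓘(ℝ, E) M) (E × E) :=
  extChartAt 𝓘(ℝ, E).tangent v

lemma mem_tangentChart_source {v w : TangentBundle 𝓘(ℝ, E) M} :
    w ∈ (tangentChart v).source ↔ w.1 ∈ (chartAt E v.1).source := by
  rw [extChartAt_source]
  exact TangentBundle.mem_chart_source_iff w v

lemma tangentChart_apply {v w : TangentBundle 𝓘(ℝ, E) M} (hw : w ∈ (tangentChart v).source) :
    tangentChart v w =
      (chartAt E v.1 w.1, mfderiv 𝓘(ℝ, E) 𝓘(ℝ, E) (chartAt E v.1) w.1 w.2) :=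
  (congrArg (Bundle.TotalSpace.toProd E E)
    (tangentMap_chart (I := 𝓘(ℝ, E)) (p := v) (q := w) (mem_tangentChart_source.1 hw))).symm

lemma mfderiv_chartAt_self (p : M) :
    mfderiv 𝓘(ℝ, E) 𝓘(ℝ, E) (chartAt E p) p = ContinuousLinearMap.id ℝ E :=
  mfderiv_extChartAt_self (I := 𝓘(ℝ, E)) (x := p)

lemma tangentChart_fiberIncl (v : TangentBundle 𝓘(ℝ, E) M) (u : E) :
    tangentChart v (fiberIncl v.1 u) = (chartAt E v.1 v.1, u) := by
  refine (tangentChart_apply (w := fiberIncl v.1 u)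
    (mem_tangentChart_source.2 (mem_chart_source E v.1))).trans ?_
  exact congrArg (fun A : E →L[ℝ] E => (chartAt E v.1 v.1, A u)) (mfderiv_chartAt_self v.1)

lemma tangentChart_self (v : TangentBundle 𝓘(ℝ, E) M) :
    tangentChart v v = (chartAt E v.1 v.1, (v.2 : E)) :=
  tangentChart_fiberIncl v v.2

lemma fiberIncl_eq (v : TangentBundle 𝓘(ℝ, E) M) (u : E) :
    fiberIncl v.1 u = (tangentChart v).symm (chartAt E v.1 v.1, u) := by
  rw [← tangentChart_fiberIncl, (tangentChart v).left_inv]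
  exact mem_tangentChart_source.2 (mem_chart_source E v.1)

lemma isOpen_slit : IsOpen (slit E M) := by
  refine isOpen_iff_mem_nhds.2 fun v hv => ?_
  have hcont : ContinuousAt (fun w => (tangentChart v w).2) v :=
    continuous_snd.continuousAt.comp (continuousAt_extChartAt v)
  have hne : (tangentChart v v).2 ≠ 0 := by
    rwa [tangentChart_self]
  filter_upwards [hcont.eventually (isOpen_ne.mem_nhds hne),
    extChartAt_source_mem_nhds (I := 𝓘(ℝ, E).tangent) v] with w hw hsource hzero
  refine hw ?_
  rw [tangentChart_apply hsource]
  exact (congrArg (mfderiv 𝓘(ℝ, E) 𝓘(ℝ, E) (chartAt E v.1) w.1) hzero).trans (map_zero _)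

lemma mdifferentiableAt_proj (v : TangentBundle 𝓘(ℝ, E) M) :
    MDifferentiableAt 𝓘(ℝ, E).tangent 𝓘(ℝ, E) (fun w : TangentBundle 𝓘(ℝ, E) M => w.1) v :=
  (Bundle.contMDiffAt_proj (n := 1) (TangentSpace 𝓘(ℝ, E))).mdifferentiableAt one_ne_zero

lemma contMDiff_fiberIncl (p : M) :
    ContMDiff 𝓘(ℝ, E) 𝓘(ℝ, E).tangent ∞
      (fun u : E => (fiberIncl p u : TangentBundle 𝓘(ℝ, E) M)) := by
  refine fun u => Bundle.contMDiffAt_totalSpace.2 ⟨contMDiffAt_const, ?_⟩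
  refine contMDiffAt_id.congr_of_eventuallyEq (.of_forall fun w => ?_)
  exact congrArg Prod.snd (tangentChart_fiberIncl (fiberIncl p u) w)

lemma mdifferentiableAt_fiberIncl (p : M) (u : E) :
    MDifferentiableAt 𝓘(ℝ, E) 𝓘(ℝ, E).tangent
      (fun u : E => (fiberIncl p u : TangentBundle 𝓘(ℝ, E) M)) u :=
  (contMDiff_fiberIncl p).mdifferentiableAt (by simp)

lemma mfderiv_apply_vlift {V : Type*} [NormedAddCommGroup V] [NormedSpace ℝ V]
    {H : Type*} [TopologicalSpace H] {J : ModelWithCorners ℝ V H}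
    {Q : Type*} [TopologicalSpace Q] [ChartedSpace H Q]
    {g : TangentBundle 𝓘(ℝ, E) M → Q} {v : TangentBundle 𝓘(ℝ, E) M}
    (hg : MDifferentiableAt 𝓘(ℝ, E).tangent J g v) (u : E) :
    mfderiv 𝓘(ℝ, E).tangent J g v (vlift v u) =
      mfderiv 𝓘(ℝ, E) J (fun w : E => g (fiberIncl v.1 w)) (v.2 : E) u :=
  (DFunLike.congr_fun (mfderiv_comp (M := E) (I := 𝓘(ℝ, E)) (v.2 : E) hg
    (mdifferentiableAt_fiberIncl (E := E) v.1 v.2)) u).symm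

section Chart

variable {v w : TangentBundle 𝓘(ℝ, E) M}

lemma mdifferentiableAt_tangentChart (hw : w ∈ (tangentChart v).source) :
    MDifferentiableAt 𝓘(ℝ, E).tangent 𝓘(ℝ, E × E) (tangentChart v) w :=
  mdifferentiableAt_extChartAt (by rwa [← extChartAt_source 𝓘(ℝ, E).tangent])

lemma mfderiv_tangentChart_vlift (hw : w ∈ (tangentChart v).source) (u : E) :
    mfderiv 𝓘(ℝ, E).tangent 𝓘(ℝ, E × E) (tangentChart v) w (vlift w u) =
      ((0 : E), (mfderiv 𝓘(ℝ, E) 𝓘(ℝ, E) (chartAt E v.1) w.1 u : E)) := by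
  have hfiber : (fun u : E => tangentChart v (fiberIncl w.1 u)) = fun u : E =>
      (chartAt E v.1 w.1, (mfderiv 𝓘(ℝ, E) 𝓘(ℝ, E) (chartAt E v.1) w.1 : E →L[ℝ] E) u) :=
    funext fun u => tangentChart_apply (w := fiberIncl w.1 u)
      (mem_tangentChart_source.2 (mem_tangentChart_source.1 hw))
  have hD := ((hasFDerivAt_const (E := E) (chartAt E v.1 w.1) w.2).prodMk
    (ContinuousLinearMap.hasFDerivAt (E := E) (F := E)
      (mfderiv 𝓘(ℝ, E) 𝓘(ℝ, E) (chartAt E v.1) w.1))).fderiv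
  refine (mfderiv_apply_vlift (mdifferentiableAt_tangentChart hw) u).trans ?_
  rw [hfiber]
  exact DFunLike.congr_fun (mfderiv_eq_fderiv.trans hD) u

lemma fst_mfderiv_tangentChart (hw : w ∈ (tangentChart v).source)
    (ξ : TangentSpace 𝓘(ℝ, E).tangent w) :
    (mfderiv 𝓘(ℝ, E).tangent 𝓘(ℝ, E × E) (tangentChart v) w ξ : E × E).1 =
      mfderiv 𝓘(ℝ, E) 𝓘(ℝ, E) (chartAt E v.1) w.1
        (mfderiv 𝓘(ℝ, E).tangent 𝓘(ℝ, E) (fun w : TangentBundle 𝓘(ℝ, E) M => w.1) w ξ) := by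
  have hproj : Prod.fst ∘ tangentChart v =ᶠ[𝓝 w]
      chartAt E v.1 ∘ fun w : TangentBundle 𝓘(ℝ, E) M => w.1 := by
    filter_upwards [(isOpen_extChartAt_source v).mem_nhds hw] with y hy
    exact congrArg Prod.fst (tangentChart_apply hy)
  have hleft := mfderiv_comp (I'' := 𝓘(ℝ, E)) w
    (differentiableAt_fst (𝕜 := ℝ)).mdifferentiableAt (mdifferentiableAt_tangentChart hw)
  have hright := mfderiv_comp w (mdifferentiableAt_atlas (I := 𝓘(ℝ, E)) (chart_mem_atlas E v.1)
    (mem_tangentChart_source.1 hw)) (mdifferentiableAt_proj w)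
  rw [mfderiv_eq_fderiv, fderiv_fst] at hleft
  exact (DFunLike.congr_fun (hleft.symm.trans (hproj.mfderiv_eq.trans hright)) ξ :)

lemma mfderiv_tangentChart_vertEndo (hw : w ∈ (tangentChart v).source)
    (ξ : TangentSpace 𝓘(ℝ, E).tangent w) :
    mfderiv 𝓘(ℝ, E).tangent 𝓘(ℝ, E × E) (tangentChart v) w (vertEndo w ξ) =
      ((0 : E), (mfderiv 𝓘(ℝ, E).tangent 𝓘(ℝ, E × E) (tangentChart v) w ξ : E × E).1) :=
  (mfderiv_tangentChart_vlift hw _).trans (congrArg _ (fst_mfderiv_tangentChart hw ξ).symm)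

end Chart

lemma mfderiv_tangentChart_self (v : TangentBundle 𝓘(ℝ, E) M) :
    mfderiv 𝓘(ℝ, E).tangent 𝓘(ℝ, E × E) (tangentChart v) v = ContinuousLinearMap.id ℝ (E × E) :=
  mfderiv_extChartAt_self (I := 𝓘(ℝ, E).tangent) (x := v)

lemma vlift_apply (v : TangentBundle 𝓘(ℝ, E) M) (u : E) : vlift v u = ((0 : E), u) := by
  have h := mfderiv_tangentChart_vlift (mem_extChartAt_source (I := 𝓘(ℝ, E).tangent) v) u
  rw [mfderiv_tangentChart_self, mfderiv_chartAt_self] at h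
  exact h

lemma mfderiv_proj_apply (v : TangentBundle 𝓘(ℝ, E) M) (ξ : E × E) :
    mfderiv 𝓘(ℝ, E).tangent 𝓘(ℝ, E) (fun w : TangentBundle 𝓘(ℝ, E) M => w.1) v ξ = ξ.1 := by
  have h := fst_mfderiv_tangentChart (mem_extChartAt_source (I := 𝓘(ℝ, E).tangent) v) ξ
  rw [mfderiv_tangentChart_self, mfderiv_chartAt_self] at h
  exact h.symm

lemma surjective_mfderiv_proj (v : TangentBundle 𝓘(ℝ, E) M) : Function.Surjective
    (mfderiv 𝓘(ℝ, E).tangent 𝓘(ℝ, E) (fun w : TangentBundle 𝓘(ℝ, E) M => w.1) v) :=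
  fun a => ⟨((a : E), (0 : E)), mfderiv_proj_apply v (a, 0)⟩

lemma exists_vlift_eq {v : TangentBundle 𝓘(ℝ, E) M} {ξ : TangentSpace 𝓘(ℝ, E).tangent v}
    (hξ : mfderiv 𝓘(ℝ, E).tangent 𝓘(ℝ, E) (fun w : TangentBundle 𝓘(ℝ, E) M => w.1) v ξ = 0) :
    ∃ u, vlift v u = ξ :=
  ⟨(ξ : E × E).2, (vlift_apply v _).trans
    (Prod.ext ((mfderiv_proj_apply v ξ).symm.trans hξ).symm rfl)⟩

lemma vertEndo_eq_liouville_iff (v : TangentBundle 𝓘(ℝ, E) M) (ξ : E × E) :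
    vertEndo v ξ = liouville v ↔ ξ.1 = v.2 := by
  have hJ : vertEndo v ξ = ((0 : E), ξ.1) :=
    (vlift_apply v _).trans (congrArg (Prod.mk 0) (mfderiv_proj_apply v ξ))
  have hC : liouville v = ((0 : E), (v.2 : E)) := vlift_apply v v.2
  rw [hJ, hC]
  exact Prod.ext_iff.trans (and_iff_right rfl)

lemma contMDiff_dilation (t : ℝ) :
    ContMDiff 𝓘(ℝ, E).tangent 𝓘(ℝ, E).tangent ∞ (dilation (E := E) (M := M) t) := by
  intro v
  obtain ⟨hproj, hsnd⟩ := Bundle.contMDiffAt_totalSpace.1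
    (contMDiffAt_id (I := 𝓘(ℝ, E).tangent) (n := ∞) (x := v))
  refine Bundle.contMDiffAt_totalSpace.2 ⟨hproj, ?_⟩
  refine ((contDiff_const_smul t).contMDiff.contMDiffAt.comp v hsnd).congr_of_eventuallyEq ?_
  filter_upwards [extChartAt_source_mem_nhds (I := 𝓘(ℝ, E).tangent) v] with w hw
  have hbase : w.1 ∈ (extChartAt 𝓘(ℝ, E) v.1).source := by
    rw [extChartAt_source]
    exact mem_tangentChart_source.1 hw
  refine (trivializationAt_tangentSpace_apply hbase (t • w.2)).trans ?_
  exact (map_smul _ t w.2).trans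
    (congrArg (t • ·) (trivializationAt_tangentSpace_apply hbase w.2).symm)

end TangentBundle

section ScaledTangentMap

variable {E : Type*} [NormedAddCommGroup E] [NormedSpace ℝ E]
  {M : Type*} [TopologicalSpace M] [ChartedSpace E M]
  {E' : Type*} [NormedAddCommGroup E'] [NormedSpace ℝ E']
  {N : Type*} [TopologicalSpace N] [ChartedSpace E' N]

lemma dilation_mem_slit {t : ℝ} (ht : t ≠ 0) {v : TangentBundle 𝓘(ℝ, E) M} :
    dilation t v ∈ slit E M ↔ v ∈ slit E M :=
  not_congr (smul_eq_zero_iff_right ht)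

/-- The map `v ↦ t φ_* v` of tangent bundles. Tangent maps are the case `t = 1` and dilations the
case `φ = id`, so that both can be treated at once. -/
def scaledTangentMap (t : ℝ) (φ : M → N) (v : TangentBundle 𝓘(ℝ, E) M) :
    TangentBundle 𝓘(ℝ, E') N :=
  dilation t (tangentMap 𝓘(ℝ, E) 𝓘(ℝ, E') φ v)

lemma scaledTangentMap_one (φ : M → N) :
    scaledTangentMap 1 φ = tangentMap 𝓘(ℝ, E) 𝓘(ℝ, E') φ :=
  funext fun _ => congrArg (Bundle.TotalSpace.mk _) (one_smul ℝ _)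

lemma scaledTangentMap_id (t : ℝ) :
    scaledTangentMap t (id : M → M) = dilation (E := E) t := by
  funext v
  rw [scaledTangentMap, tangentMap_id, id]

variable [IsManifold 𝓘(ℝ, E) ∞ M] [IsManifold 𝓘(ℝ, E') ∞ N] {φ : M → N}

lemma contMDiff_scaledTangentMap (t : ℝ) (hφ : ContMDiff 𝓘(ℝ, E) 𝓘(ℝ, E') ∞ φ) :
    ContMDiff 𝓘(ℝ, E).tangent 𝓘(ℝ, E').tangent ∞
      (scaledTangentMap (E := E) (E' := E') t φ) :=
  (contMDiff_dilation t).comp (hφ.contMDiff_tangentMap (by simp))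

lemma mdifferentiableAt_scaledTangentMap (t : ℝ) (hφ : ContMDiff 𝓘(ℝ, E) 𝓘(ℝ, E') ∞ φ)
    (v : TangentBundle 𝓘(ℝ, E) M) :
    MDifferentiableAt 𝓘(ℝ, E).tangent 𝓘(ℝ, E').tangent (scaledTangentMap (E' := E') t φ) v :=
  (contMDiff_scaledTangentMap t hφ).mdifferentiableAt (by simp)

lemma mfderiv_scaledTangentMap_vlift (t : ℝ) (hφ : ContMDiff 𝓘(ℝ, E) 𝓘(ℝ, E') ∞ φ)
    (v : TangentBundle 𝓘(ℝ, E) M) (u : TangentSpace 𝓘(ℝ, E) v.1) :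
    mfderiv 𝓘(ℝ, E).tangent 𝓘(ℝ, E').tangent (scaledTangentMap t φ) v (vlift v u) =
      vlift (scaledTangentMap t φ v) (t • mfderiv 𝓘(ℝ, E) 𝓘(ℝ, E') φ v.1 u) := by
  let A : E →L[ℝ] E' := t • (mfderiv 𝓘(ℝ, E) 𝓘(ℝ, E') φ v.1 : E →L[ℝ] E')
  have hfiber := mfderiv_comp (M := E) (M' := E') v.2
    (mdifferentiableAt_fiberIncl (E := E') (φ v.1) (A v.2))
    (A.contMDiff.mdifferentiableAt one_ne_zero)
  refine (mfderiv_apply_vlift (mdifferentiableAt_scaledTangentMap t hφ v) u).trans ?_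
  refine (DFunLike.congr_fun hfiber u).trans (congrArg (vlift (scaledTangentMap t φ v)) ?_)
  exact DFunLike.congr_fun (mfderiv_eq_fderiv.trans A.fderiv) u

lemma mfderiv_proj_mfderiv_scaledTangentMap (t : ℝ) (hφ : ContMDiff 𝓘(ℝ, E) 𝓘(ℝ, E') ∞ φ)
    (v : TangentBundle 𝓘(ℝ, E) M) (ξ : TangentSpace 𝓘(ℝ, E).tangent v) :
    mfderiv 𝓘(ℝ, E').tangent 𝓘(ℝ, E') (fun w : TangentBundle 𝓘(ℝ, E') N => w.1)
        (scaledTangentMap t φ v)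
        (mfderiv 𝓘(ℝ, E).tangent 𝓘(ℝ, E').tangent (scaledTangentMap t φ) v ξ) =
      mfderiv 𝓘(ℝ, E) 𝓘(ℝ, E') φ v.1
        (mfderiv 𝓘(ℝ, E).tangent 𝓘(ℝ, E) (fun w : TangentBundle 𝓘(ℝ, E) M => w.1) v ξ) :=
  have hupper := mfderiv_comp v (mdifferentiableAt_proj (scaledTangentMap t φ v))
    (mdifferentiableAt_scaledTangentMap t hφ v)
  have hlower := mfderiv_comp v (hφ.mdifferentiableAt (by simp)) (mdifferentiableAt_proj v)
  DFunLike.congr_fun (hupper.symm.trans hlower) ξ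

lemma mfderiv_scaledTangentMap_vertEndo (t : ℝ) (hφ : ContMDiff 𝓘(ℝ, E) 𝓘(ℝ, E') ∞ φ)
    (v : TangentBundle 𝓘(ℝ, E) M) (ξ : TangentSpace 𝓘(ℝ, E).tangent v) :
    mfderiv 𝓘(ℝ, E).tangent 𝓘(ℝ, E').tangent (scaledTangentMap t φ) v (vertEndo v ξ) =
      t • vertEndo (scaledTangentMap t φ v)
        (mfderiv 𝓘(ℝ, E).tangent 𝓘(ℝ, E').tangent (scaledTangentMap t φ) v ξ) := by
  refine (mfderiv_scaledTangentMap_vlift t hφ v _).trans ((map_smul _ t _).trans ?_)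
  exact congrArg (t • vlift (scaledTangentMap t φ v) ·)
    (mfderiv_proj_mfderiv_scaledTangentMap t hφ v ξ).symm

lemma surjective_mfderiv_scaledTangentMap {t : ℝ} (ht : t ≠ 0)
    (hφ : ContMDiff 𝓘(ℝ, E) 𝓘(ℝ, E') ∞ φ) {v : TangentBundle 𝓘(ℝ, E) M}
    (hsurj : Function.Surjective (mfderiv 𝓘(ℝ, E) 𝓘(ℝ, E') φ v.1)) : Function.Surjective
      (mfderiv 𝓘(ℝ, E).tangent 𝓘(ℝ, E').tangent (scaledTangentMap (E' := E') t φ) v) := by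
  intro η
  obtain ⟨a, ha⟩ := hsurj (mfderiv 𝓘(ℝ, E').tangent 𝓘(ℝ, E')
    (fun w : TangentBundle 𝓘(ℝ, E') N => w.1) (scaledTangentMap t φ v) η)
  obtain ⟨ξ, rfl⟩ := surjective_mfderiv_proj v a
  obtain ⟨u, hu⟩ := exists_vlift_eq
    (ξ := η - mfderiv 𝓘(ℝ, E).tangent 𝓘(ℝ, E').tangent (scaledTangentMap t φ) v ξ)
    (by rw [map_sub, mfderiv_proj_mfderiv_scaledTangentMap t hφ, ha, sub_self])
  obtain ⟨b, hb⟩ := hsurj (t⁻¹ • u)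
  have hvert := (mfderiv_scaledTangentMap_vlift t hφ v b).trans (congrArg (vlift _)
    ((congrArg (t • ·) hb).trans (smul_inv_smul₀ ht u)))
  refine ⟨ξ + vlift v b, (map_add _ _ _).trans ?_⟩
  rw [hvert, hu, add_sub_cancel]

end ScaledTangentMap

section CartanForm

variable {E : Type*} [NormedAddCommGroup E] [NormedSpace ℝ E]
  {M : Type*} [TopologicalSpace M] [ChartedSpace E M] [IsManifold 𝓘(ℝ, E) ∞ M]
  {E' : Type*} [NormedAddCommGroup E'] [NormedSpace ℝ E']
  {N : Type*} [TopologicalSpace N] [ChartedSpace E' N] [IsManifold 𝓘(ℝ, E') ∞ N]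
  {F : TangentBundle 𝓘(ℝ, E) M → ℝ} {F' : TangentBundle 𝓘(ℝ, E') N → ℝ}

/-- The Cartan 1-form `dE ∘ 𝐉`, where `E` is the energy of `F`. -/
def cartanForm (F : TangentBundle 𝓘(ℝ, E) M → ℝ) (v : TangentBundle 𝓘(ℝ, E) M) :
    TangentSpace 𝓘(ℝ, E).tangent v →L[ℝ] ℝ :=
  (diff (energy F) v).comp (vertEndo v)

/-- The equation `i_ξ d(dE ∘ 𝐉) = -dE` at `v`, which characterizes the value at `v` of the
canonical spray. -/
def IsSprayValue (F : TangentBundle 𝓘(ℝ, E) M → ℝ) (v : TangentBundle 𝓘(ℝ, E) M)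
    (ξ : TangentSpace 𝓘(ℝ, E).tangent v) : Prop :=
  ∀ η, oneFormExtDeriv 𝓘(ℝ, E).tangent (cartanForm F) v ξ η = -diff (energy F) v η

section Naturality

lemma diff_energy_mfderiv_scaledTangentMap {t : ℝ} (ht : t ≠ 0) {φ : M → N}
    (hφ : ContMDiff 𝓘(ℝ, E) 𝓘(ℝ, E') ∞ φ)
    (henergy : ∀ w, energy F' (scaledTangentMap t φ w) = t ^ 2 * energy F w)
    {v : TangentBundle 𝓘(ℝ, E) M} (hF' : MDifferentiableAt 𝓘(ℝ, E').tangent 𝓘(ℝ, ℝ)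
      (energy F') (scaledTangentMap t φ v)) (η : TangentSpace 𝓘(ℝ, E).tangent v) :
    diff (energy F') (scaledTangentMap t φ v)
        (mfderiv 𝓘(ℝ, E).tangent 𝓘(ℝ, E').tangent (scaledTangentMap t φ) v η) =
      t ^ 2 * diff (energy F) v η := by
  have hcomp := mfderiv_comp v hF' (mdifferentiableAt_scaledTangentMap t hφ v)
  have hscale : energy F' ∘ scaledTangentMap t φ = t ^ 2 • energy F := funext henergy
  have hF : MDifferentiableAt 𝓘(ℝ, E).tangent 𝓘(ℝ, ℝ) (energy F) v := by
    rw [← inv_smul_smul₀ (pow_ne_zero 2 ht) (energy F), ← hscale]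
    exact (hF'.comp v (mdifferentiableAt_scaledTangentMap t hφ v)).const_smul _
  rw [hscale, const_smul_mfderiv hF] at hcomp
  exact (DFunLike.congr_fun hcomp η).symm

lemma oneFormPullback_scaledTangentMap_cartanForm {t : ℝ} (ht : t ≠ 0) {φ : M → N}
    (hφ : ContMDiff 𝓘(ℝ, E) 𝓘(ℝ, E') ∞ φ)
    (henergy : ∀ w, energy F' (scaledTangentMap t φ w) = t ^ 2 * energy F w)
    {v : TangentBundle 𝓘(ℝ, E) M} (hF' : MDifferentiableAt 𝓘(ℝ, E').tangent 𝓘(ℝ, ℝ)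
      (energy F') (scaledTangentMap t φ v)) :
    oneFormPullback 𝓘(ℝ, E).tangent 𝓘(ℝ, E').tangent (scaledTangentMap t φ) (cartanForm F') v =
      t • cartanForm F v := by
  ext η
  have h := diff_energy_mfderiv_scaledTangentMap ht hφ henergy hF' (vertEndo v η)
  rw [mfderiv_scaledTangentMap_vertEndo t hφ, map_smul, sq, mul_assoc] at h
  exact mul_left_cancel₀ ht h

lemma IsSprayValue.map_scaledTangentMap {t : ℝ} (ht : t ≠ 0) {φ : M → N}
    (hφ : ContMDiff 𝓘(ℝ, E) 𝓘(ℝ, E') ∞ φ)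
    (henergy : ∀ w, energy F' (scaledTangentMap t φ w) = t ^ 2 * energy F w)
    {v : TangentBundle 𝓘(ℝ, E) M}
    (hF' : ∀ᶠ w in 𝓝 (scaledTangentMap (E' := E') t φ v),
      MDifferentiableAt 𝓘(ℝ, E').tangent 𝓘(ℝ, ℝ) (energy F') w)
    (hθ : DifferentiableAt ℝ
      (oneFormInChart 𝓘(ℝ, E').tangent (cartanForm F') (scaledTangentMap t φ v))
      (tangentChart (scaledTangentMap t φ v) (scaledTangentMap t φ v)))
    (hsurj : Function.Surjective (mfderiv 𝓘(ℝ, E) 𝓘(ℝ, E') φ v.1))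
    {ξ : TangentSpace 𝓘(ℝ, E).tangent v} (hξ : IsSprayValue F v ξ) :
    IsSprayValue F' (scaledTangentMap t φ v)
      (t • mfderiv 𝓘(ℝ, E).tangent 𝓘(ℝ, E').tangent (scaledTangentMap t φ) v ξ) := by
  intro η'
  obtain ⟨η, rfl⟩ := surjective_mfderiv_scaledTangentMap ht hφ hsurj η'
  have hg := contMDiff_scaledTangentMap t hφ
  have hpull : ∀ᶠ w in 𝓝 v, oneFormPullback 𝓘(ℝ, E).tangent 𝓘(ℝ, E').tangent
      (scaledTangentMap t φ) (cartanForm F') w = t • cartanForm F w := by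
    filter_upwards [hg.continuous.continuousAt.eventually hF'] with w hw
    exact oneFormPullback_scaledTangentMap_cartanForm ht hφ henergy hw
  calc
    oneFormExtDeriv 𝓘(ℝ, E').tangent (cartanForm F') (scaledTangentMap t φ v)
        (t • mfderiv 𝓘(ℝ, E).tangent 𝓘(ℝ, E').tangent (scaledTangentMap t φ) v ξ)
        (mfderiv 𝓘(ℝ, E).tangent 𝓘(ℝ, E').tangent (scaledTangentMap t φ) v η) =
      t * oneFormExtDeriv 𝓘(ℝ, E').tangent (cartanForm F') (scaledTangentMap t φ v)
        (mfderiv 𝓘(ℝ, E).tangent 𝓘(ℝ, E').tangent (scaledTangentMap t φ) v ξ)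
        (mfderiv 𝓘(ℝ, E).tangent 𝓘(ℝ, E').tangent (scaledTangentMap t φ) v η) :=
      oneFormExtDeriv_smul_left t _ _ _ _
    _ = t * (t * oneFormExtDeriv 𝓘(ℝ, E).tangent (cartanForm F) v ξ η) := by
      rw [← oneFormExtDeriv_oneFormPullback (hg.of_le ENat.LEInfty.out).contMDiffAt hθ,
        oneFormExtDeriv_congr hpull, oneFormExtDeriv_const_smul]
    _ = -(t ^ 2 * diff (energy F) v η) := by rw [hξ η]; ring
    _ = _ := by
      rw [diff_energy_mfderiv_scaledTangentMap ht hφ henergy hF'.self_of_nhds]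

end Naturality

section Chart

/-- The energy of `F` in the preferred chart of the tangent bundle at `v`. -/
def chartEnergy (F : TangentBundle 𝓘(ℝ, E) M → ℝ) (v : TangentBundle 𝓘(ℝ, E) M) :
    E × E → ℝ :=
  energy F ∘ (tangentChart v).symm

lemma mfderiv_tangentChart_symm_vertical {v : TangentBundle 𝓘(ℝ, E) M} {z : E × E}
    (hz : z ∈ (tangentChart v).target) (b : E × E) :
    mfderiv 𝓘(ℝ, E × E) 𝓘(ℝ, E).tangent (tangentChart v).symm z ((0 : E), b.1) =
      vertEndo ((tangentChart v).symm z)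
        (mfderiv 𝓘(ℝ, E × E) 𝓘(ℝ, E).tangent (tangentChart v).symm z b) := by
  have hw := (tangentChart v).map_target hz
  have hinv := mfderiv_extChartAt_comp_mfderivWithin_extChartAt_symm hz
  rw [ModelWithCorners.range_eq_univ, mfderivWithin_univ] at hinv
  refine (isInvertible_mfderiv_extChartAt hw).injective ?_
  rw [mfderiv_tangentChart_vertEndo hw]
  refine (DFunLike.congr_fun hinv _).trans ?_
  exact congrArg (fun c : E × E => ((0 : E), c.1)) (DFunLike.congr_fun hinv b).symm

lemma oneFormInChart_diff_energy {v : TangentBundle 𝓘(ℝ, E) M} {z : E × E}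
    (hz : z ∈ (tangentChart v).target)
    (hF : MDifferentiableAt 𝓘(ℝ, E).tangent 𝓘(ℝ, ℝ) (energy F) ((tangentChart v).symm z)) :
    oneFormInChart 𝓘(ℝ, E).tangent (diff (energy F)) v z = fderiv ℝ (chartEnergy F v) z :=
  (mfderiv_comp z hF ((contMDiffAt_extChartAt_symm (n := 1) hz).mdifferentiableAt
    one_ne_zero)).symm.trans mfderiv_eq_fderiv

lemma oneFormInChart_cartanForm {v : TangentBundle 𝓘(ℝ, E) M} {z : E × E}
    (hz : z ∈ (tangentChart v).target)
    (hF : MDifferentiableAt 𝓘(ℝ, E).tangent 𝓘(ℝ, ℝ) (energy F) ((tangentChart v).symm z)) :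
    oneFormInChart 𝓘(ℝ, E).tangent (cartanForm F) v z = vertForm (chartEnergy F v) z := by
  refine ContinuousLinearMap.ext fun (b : E × E) => ?_
  have h := DFunLike.congr_fun (oneFormInChart_diff_energy hz hF) ((0 : E), b.1)
  exact (congrArg (diff (energy F) ((tangentChart v).symm z))
    (mfderiv_tangentChart_symm_vertical hz b).symm).trans h

end Chart

end CartanForm

section Finsler

variable {E : Type*} [NormedAddCommGroup E] [NormedSpace ℝ E]
  {M : Type*} [TopologicalSpace M] [ChartedSpace E M] [IsManifold 𝓘(ℝ, E) ∞ M]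
  {F : TangentBundle 𝓘(ℝ, E) M → ℝ} {v : TangentBundle 𝓘(ℝ, E) M}

lemma contDiffAt_chartEnergy (hE : ContMDiffAt 𝓘(ℝ, E).tangent 𝓘(ℝ, ℝ) ∞ (energy F) v) :
    ContDiffAt ℝ ∞ (chartEnergy F v) (tangentChart v v) := by
  refine ContMDiffAt.contDiffAt (ContMDiffAt.comp _ ?_
    (contMDiffAt_extChartAt_symm (mem_extChartAt_target v)))
  rwa [(tangentChart v).left_inv (mem_extChartAt_source v)]

lemma eventually_tangentChart_symm {P : TangentBundle 𝓘(ℝ, E) M → Prop} (h : ∀ᶠ w in 𝓝 v, P w) :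
    ∀ᶠ z in 𝓝 (tangentChart v v), z ∈ (tangentChart v).target ∧ P ((tangentChart v).symm z) := by
  rw [← (tangentChart v).left_inv (mem_extChartAt_source v)] at h
  exact Filter.Eventually.and (extChartAt_target_mem_nhds v)
    ((continuousAt_extChartAt_symm (I := 𝓘(ℝ, E).tangent) v).eventually h)

lemma eventually_mdifferentiableAt_energy
    (hE : ContMDiffAt 𝓘(ℝ, E).tangent 𝓘(ℝ, ℝ) ∞ (energy F) v) :
    ∀ᶠ w in 𝓝 v, MDifferentiableAt 𝓘(ℝ, E).tangent 𝓘(ℝ, ℝ) (energy F) w :=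
  ((contMDiffAt_iff_contMDiffAt_nhds (n := 1) (by simp)).1 (hE.of_le (by simp))).mono
    fun _ hw => hw.mdifferentiableAt one_ne_zero

lemma oneFormInChart_diff_energy_eventuallyEq
    (hE : ContMDiffAt 𝓘(ℝ, E).tangent 𝓘(ℝ, ℝ) ∞ (energy F) v) :
    oneFormInChart 𝓘(ℝ, E).tangent (diff (energy F)) v =ᶠ[𝓝 (tangentChart v v)]
      fderiv ℝ (chartEnergy F v) :=
  (eventually_tangentChart_symm (eventually_mdifferentiableAt_energy hE)).mono
    fun _ hz => oneFormInChart_diff_energy hz.1 hz.2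

lemma oneFormInChart_cartanForm_eventuallyEq
    (hE : ContMDiffAt 𝓘(ℝ, E).tangent 𝓘(ℝ, ℝ) ∞ (energy F) v) :
    oneFormInChart 𝓘(ℝ, E).tangent (cartanForm F) v =ᶠ[𝓝 (tangentChart v v)]
      vertForm (chartEnergy F v) :=
  (eventually_tangentChart_symm (eventually_mdifferentiableAt_energy hE)).mono
    fun _ hz => oneFormInChart_cartanForm hz.1 hz.2

lemma contDiffAt_oneFormInChart_cartanForm
    (hE : ContMDiffAt 𝓘(ℝ, E).tangent 𝓘(ℝ, ℝ) ∞ (energy F) v) :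
    ContDiffAt ℝ ∞ (oneFormInChart 𝓘(ℝ, E).tangent (cartanForm F) v) (tangentChart v v) :=
  (contDiffAt_vertForm (contDiffAt_chartEnergy hE) (by simp)).congr_of_eventuallyEq
    (oneFormInChart_cartanForm_eventuallyEq hE)

lemma extDerivBilin_cartanForm (hE : ContMDiffAt 𝓘(ℝ, E).tangent 𝓘(ℝ, ℝ) ∞ (energy F) v) :
    extDerivBilin (oneFormInChart 𝓘(ℝ, E).tangent (cartanForm F) v) (tangentChart v v) =
      extDerivBilin (vertForm (chartEnergy F v)) (tangentChart v v) := by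
  rw [extDerivBilin, (oneFormInChart_cartanForm_eventuallyEq hE).fderiv_eq, ← extDerivBilin]

lemma isSprayValue_iff (hE : ContMDiffAt 𝓘(ℝ, E).tangent 𝓘(ℝ, ℝ) ∞ (energy F) v) (ξ : E × E) :
    IsSprayValue F v ξ ↔ extDerivBilin (vertForm (chartEnergy F v)) (tangentChart v v) ξ =
      -fderiv ℝ (chartEnergy F v) (tangentChart v v) := by
  have hdiff : fderiv ℝ (chartEnergy F v) (tangentChart v v) = diff (energy F) v :=
    (oneFormInChart_diff_energy_eventuallyEq hE).self_of_nhds.symm.trans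
      (oneFormInChart_extChartAt_self (diff (energy F)) v)
  rw [← extDerivBilin_cartanForm hE, ContinuousLinearMap.ext_iff]
  refine forall_congr' fun η => Eq.congr (oneFormExtDeriv_eq_extDerivBilin _ v ξ η) ?_
  exact congrArg (-·) (DFunLike.congr_fun hdiff η).symm

lemma fiberSq_eq (F : TangentBundle 𝓘(ℝ, E) M → ℝ) (v : TangentBundle 𝓘(ℝ, E) M) :
    fiberSq F v.1 = fun u => 2 * chartEnergy F v ((tangentChart v v).1, u) := by
  funext u
  rw [tangentChart_self, chartEnergy, Function.comp_apply, ← fiberIncl_eq, energy, fiberSq]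
  ring

namespace IsFinslerFunction

lemma contMDiffAt_energy (hF : IsFinslerFunction F) (hv : v ∈ slit E M) :
    ContMDiffAt 𝓘(ℝ, E).tangent 𝓘(ℝ, ℝ) ∞ (energy F) v :=
  have hsq : ContDiff ℝ ∞ fun x : ℝ => (1 / 2) * x ^ 2 := by fun_prop
  hsq.contMDiff.contMDiffAt.comp v (hF.smooth.contMDiffAt (isOpen_slit.mem_nhds hv))

lemma energy_dilation (hF : IsFinslerFunction F) {t : ℝ} (ht : 0 < t) :
    energy F (dilation t v) = t ^ 2 * energy F v := by
  rw [energy, hF.homogeneous t v ht, energy]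
  ring

lemma fderiv_fderiv_chartEnergy_pos (hF : IsFinslerFunction F) (hv : v ∈ slit E M) {b : E}
    (hb : b ≠ 0) :
    0 < fderiv ℝ (fderiv ℝ (chartEnergy F v)) (tangentChart v v) (0, b) (0, b) := by
  have hL : ContDiffAt ℝ 2 (chartEnergy F v) (tangentChart v v) :=
    (contDiffAt_chartEnergy (hF.contMDiffAt_energy hv)).of_le ENat.LEInfty.out
  set f := fun u => chartEnergy F v ((tangentChart v v).1, u)
  have hsq : fiberSq F v.1 = (2 : ℝ) • f := fiberSq_eq F v
  have hsnd : (tangentChart v v).2 = v.2 := by rw [tangentChart_self]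
  have hD : fderiv ℝ (fderiv ℝ (fiberSq F v.1)) = (2 : ℝ) • fderiv ℝ (fderiv ℝ f) := by
    have hfst : fderiv ℝ (fiberSq F v.1) = (2 : ℝ) • fderiv ℝ f := by
      rw [hsq]
      exact fderiv_const_smul_field (f := f) (2 : ℝ)
    rw [hfst]
    exact fderiv_const_smul_field (f := fderiv ℝ f) (2 : ℝ)
  have hpos : 0 < (2 : ℝ) * fderiv ℝ (fderiv ℝ f) (tangentChart v v).2 b b := by
    have h := hF.elliptic v.1 (tangentChart v v).2 b (hsnd ▸ hv) hb
    rwa [hD] at h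
  have hslice := fderiv_fderiv_comp_prodMk_left (x := (tangentChart v v).1)
    (y := (tangentChart v v).2) hL b b
  exact (pos_of_mul_pos_right hpos two_pos.le).trans_eq hslice

lemma chartEnergy_smul (hF : IsFinslerFunction F) {t : ℝ} (ht : 0 < t) (u : E) :
    chartEnergy F v ((tangentChart v v).1, t • u) =
      t ^ 2 • chartEnergy F v ((tangentChart v v).1, u) := by
  simp only [tangentChart_self, chartEnergy, Function.comp_apply, ← fiberIncl_eq]
  exact hF.energy_dilation (v := fiberIncl v.1 u) ht

lemma fderiv_fderiv_chartEnergy_self (hF : IsFinslerFunction F) (hv : v ∈ slit E M) (b : E) :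
    fderiv ℝ (fderiv ℝ (chartEnergy F v)) (tangentChart v v) (0, b) (0, (tangentChart v v).2) =
      fderiv ℝ (chartEnergy F v) (tangentChart v v) (0, b) := by
  have hL : ContDiffAt ℝ 2 (chartEnergy F v) (tangentChart v v) :=
    (contDiffAt_chartEnergy (hF.contMDiffAt_energy hv)).of_le ENat.LEInfty.out
  have hfiber : ContDiffAt ℝ 2 (fun u => chartEnergy F v ((tangentChart v v).1, u))
      (tangentChart v v).2 :=
    ContDiffAt.comp (E := E) (F := E × E) _ hL (contDiffAt_const.prodMk contDiffAt_id)
  have heuler := fderiv_fderiv_apply_self_of_homogeneous hfiber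
    (fun t u ht => hF.chartEnergy_smul ht u) b
  have hslice := fderiv_comp_prodMk_left (x := (tangentChart v v).1) (y := (tangentChart v v).2)
    (hL.differentiableAt two_ne_zero) b
  exact (fderiv_fderiv_comp_prodMk_left (x := (tangentChart v v).1) hL b _).symm.trans
    (heuler.trans hslice)

lemma injective_extDerivBilin (hF : IsFinslerFunction F) (hv : v ∈ slit E M) :
    Function.Injective (extDerivBilin (vertForm (chartEnergy F v)) (tangentChart v v)) :=
  injective_extDerivBilin_vertForm
    ((contDiffAt_chartEnergy (hF.contMDiffAt_energy hv)).of_le ENat.LEInfty.out)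
    fun _ => hF.fderiv_fderiv_chartEnergy_pos hv

lemma eq_of_isSprayValue (hF : IsFinslerFunction F) (hv : v ∈ slit E M)
    {ξ ξ' : TangentSpace 𝓘(ℝ, E).tangent v} (hξ : IsSprayValue F v ξ)
    (hξ' : IsSprayValue F v ξ') : ξ = ξ' :=
  hF.injective_extDerivBilin hv
    (((isSprayValue_iff (hF.contMDiffAt_energy hv) ξ).1 hξ).trans
      ((isSprayValue_iff (hF.contMDiffAt_energy hv) ξ').1 hξ').symm)

lemma vertEndo_eq_liouville_of_isSprayValue (hF : IsFinslerFunction F) (hv : v ∈ slit E M)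
    {ξ : TangentSpace 𝓘(ℝ, E).tangent v} (hξ : IsSprayValue F v ξ) :
    vertEndo v ξ = liouville v := by
  have hE := hF.contMDiffAt_energy hv
  refine (vertEndo_eq_liouville_iff v ξ).2 ?_
  have h := fst_eq_of_extDerivBilin_vertForm
    ((contDiffAt_chartEnergy hE).of_le ENat.LEInfty.out)
    (fun _ => hF.fderiv_fderiv_chartEnergy_pos hv) (hF.fderiv_fderiv_chartEnergy_self hv)
    ((isSprayValue_iff hE ξ).1 hξ)
  rwa [tangentChart_self] at h

lemma isSprayValue_map_scaledTangentMap {E' : Type*} [NormedAddCommGroup E'] [NormedSpace ℝ E']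
    {N : Type*} [TopologicalSpace N] [ChartedSpace E' N] [IsManifold 𝓘(ℝ, E') ∞ N]
    {F' : TangentBundle 𝓘(ℝ, E') N → ℝ} (hF' : IsFinslerFunction F') {t : ℝ} (ht : t ≠ 0)
    {φ : M → N} (hφ : ContMDiff 𝓘(ℝ, E) 𝓘(ℝ, E') ∞ φ)
    (henergy : ∀ w, energy F' (scaledTangentMap t φ w) = t ^ 2 * energy F w)
    (hv : scaledTangentMap t φ v ∈ slit E' N)
    (hsurj : Function.Surjective (mfderiv 𝓘(ℝ, E) 𝓘(ℝ, E') φ v.1))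
    {ξ : TangentSpace 𝓘(ℝ, E).tangent v} (hξ : IsSprayValue F v ξ) :
    IsSprayValue F' (scaledTangentMap t φ v)
      (t • mfderiv 𝓘(ℝ, E).tangent 𝓘(ℝ, E').tangent (scaledTangentMap t φ) v ξ) :=
  have hE' := hF'.contMDiffAt_energy hv
  hξ.map_scaledTangentMap ht hφ henergy (eventually_mdifferentiableAt_energy hE')
    ((contDiffAt_oneFormInChart_cartanForm hE').differentiableAt (by simp)) hsurj

section FiniteDimensional

variable [FiniteDimensional ℝ E]

lemma isInvertible_extDerivBilin (hF : IsFinslerFunction F) (hv : v ∈ slit E M) :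
    (extDerivBilin (vertForm (chartEnergy F v)) (tangentChart v v)).IsInvertible :=
  isInvertible_of_injective_dual (hF.injective_extDerivBilin hv)

lemma exists_isSprayValue (hF : IsFinslerFunction F) (hv : v ∈ slit E M) :
    ∃ ξ, IsSprayValue F v ξ :=
  let ⟨ξ, hξ⟩ := (hF.isInvertible_extDerivBilin hv).surjective
    (-fderiv ℝ (chartEnergy F v) (tangentChart v v))
  ⟨ξ, (isSprayValue_iff (hF.contMDiffAt_energy hv) ξ).2 hξ⟩

lemma contMDiffAt_of_isSprayValue (hF : IsFinslerFunction F) (hv : v ∈ slit E M)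
    {S : ∀ v : TangentBundle 𝓘(ℝ, E) M, TangentSpace 𝓘(ℝ, E).tangent v}
    (hS : ∀ w ∈ slit E M, IsSprayValue F w (S w)) :
    ContMDiffAt 𝓘(ℝ, E).tangent 𝓘(ℝ, E).tangent.tangent ∞
      (fun w => (⟨w, S w⟩ : TangentBundle 𝓘(ℝ, E).tangent (TangentBundle 𝓘(ℝ, E) M))) v := by
  have hE := hF.contMDiffAt_energy hv
  have hα : ContDiffAt ℝ ∞ (oneFormInChart 𝓘(ℝ, E).tangent (-diff (energy F)) v)
      (tangentChart v v) :=
    (ContDiffAt.fderiv_right (contDiffAt_chartEnergy hE) (by simp)).neg.congr_of_eventuallyEq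
      ((oneFormInChart_diff_energy_eventuallyEq hE).fun_comp Neg.neg)
  have : CompleteSpace (E × E) := FiniteDimensional.complete ℝ (E × E)
  refine contMDiffAt_of_oneFormExtDeriv_eq (contDiffAt_oneFormInChart_cartanForm hE) hα ?_ ?_
  · rw [extDerivBilin_cartanForm hE]
    exact hF.isInvertible_extDerivBilin hv
  · filter_upwards [isOpen_slit.mem_nhds hv] with w hw using hS w hw

end FiniteDimensional

end IsFinslerFunction

end Finsler

section Spray

variable {E : Type*} [NormedAddCommGroup E] [NormedSpace ℝ E]
  {M : Type*} [TopologicalSpace M] [ChartedSpace E M] [IsManifold 𝓘(ℝ, E) ∞ M]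
  {v : TangentBundle 𝓘(ℝ, E) M}

lemma mfderiv_dilation_vlift (t : ℝ) (v : TangentBundle 𝓘(ℝ, E) M) (u : E) :
    mfderiv 𝓘(ℝ, E).tangent 𝓘(ℝ, E).tangent (dilation (M := M) t) v (vlift v u) =
      vlift (dilation t v) (t • u : E) := by
  have h := mfderiv_scaledTangentMap_vlift t (contMDiff_id (I := 𝓘(ℝ, E)) (M := M)) v u
  rw [scaledTangentMap_id, mfderiv_id] at h
  exact h

lemma IsSpray.eq_zero {S : ∀ v : TangentBundle 𝓘(ℝ, E) M, TangentSpace 𝓘(ℝ, E).tangent v}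
    (hS : IsSpray S) (hv : v ∉ slit E M) : S v = 0 := by
  have hsnd : v.2 = 0 := not_not.1 hv
  have hfst := (vertEndo_eq_liouville_iff v (S v)).1 (hS.vertEndo_eq v)
  obtain ⟨u, hu⟩ := exists_vlift_eq ((mfderiv_proj_apply v (S v)).trans (hfst.trans hsnd))
  have hfix : dilation 2 v = v :=
    congrArg (Bundle.TotalSpace.mk v.1) ((congrArg ((2 : ℝ) • ·) hsnd).trans
      ((smul_zero _).trans hsnd.symm))
  have hhom := hS.homogeneous 2 v two_pos
  rw [← hu] at hhom
  have hdil := mfderiv_dilation_vlift 2 v u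
  rw [hdil, hfix, ← hu] at hhom
  have hscale : u = (2 : ℝ) • (2 : ℝ) • u := congrArg Prod.snd ((vlift_apply v u).symm.trans
    (hhom.trans (congrArg (fun ζ : E × E => (2 : ℝ) • ζ) (vlift_apply v _))))
  have hzero : u = 0 := by linear_combination (norm := module) (-1 / 3 : ℝ) • hscale
  rw [← hu, hzero, map_zero]

lemma IsFinslerFunction.isSprayValue_dilation {F : TangentBundle 𝓘(ℝ, E) M → ℝ}
    (hF : IsFinslerFunction F) (hv : v ∈ slit E M) {t : ℝ} (ht : 0 < t)
    {ξ : TangentSpace 𝓘(ℝ, E).tangent v} (hξ : IsSprayValue F v ξ) :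
    IsSprayValue F (dilation t v)
      (t • mfderiv 𝓘(ℝ, E).tangent 𝓘(ℝ, E).tangent (dilation t) v ξ) := by
  have hsurj : Function.Surjective (mfderiv 𝓘(ℝ, E) 𝓘(ℝ, E) (id : M → M) v.1) := by
    rw [mfderiv_id]
    exact Function.surjective_id
  have h := hF.isSprayValue_map_scaledTangentMap (F := F) (v := v) ht.ne'
    (contMDiff_id (I := 𝓘(ℝ, E)) (M := M))
  rw [scaledTangentMap_id] at h
  exact h (fun _ => hF.energy_dilation ht) ((dilation_mem_slit ht.ne').2 hv) hsurj hξ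

lemma IsFinslerFunction.exists_isCanonicalSpray [FiniteDimensional ℝ E]
    {F : TangentBundle 𝓘(ℝ, E) M → ℝ} (hF : IsFinslerFunction F) :
    ∃ S, IsCanonicalSpray F S := by
  have hvalue (v : TangentBundle 𝓘(ℝ, E) M) : ∃ ξ : TangentSpace 𝓘(ℝ, E).tangent v,
      (v ∈ slit E M → IsSprayValue F v ξ) ∧ (v ∉ slit E M → ξ = 0) := by
    by_cases hv : v ∈ slit E M
    · exact (hF.exists_isSprayValue hv).imp fun ξ hξ => ⟨fun _ => hξ, absurd hv⟩
    · exact ⟨0, fun h => absurd h hv, fun _ => rfl⟩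
  choose S hS hzero using hvalue
  refine ⟨S, ⟨?_, ?_, ?_⟩, hS⟩
  · exact fun v hv => (hF.contMDiffAt_of_isSprayValue hv hS).contMDiffWithinAt
  · intro t v ht
    by_cases hv : v ∈ slit E M
    · have htv := (dilation_mem_slit ht.ne').2 hv
      exact hF.eq_of_isSprayValue htv (hS _ htv) (hF.isSprayValue_dilation hv ht (hS v hv))
    · rw [hzero v hv, hzero _ (mt (dilation_mem_slit ht.ne').1 hv), map_zero, smul_zero]
  · intro v
    by_cases hv : v ∈ slit E M
    · exact hF.vertEndo_eq_liouville_of_isSprayValue hv (hS v hv)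
    · rw [hzero v hv, map_zero, liouville, not_not.1 hv, map_zero]

end Spray

section Isometry

variable {E : Type*} [NormedAddCommGroup E] [NormedSpace ℝ E]
  {M : Type*} [TopologicalSpace M] [ChartedSpace E M]
  {E' : Type*} [NormedAddCommGroup E'] [NormedSpace ℝ E']
  {N : Type*} [TopologicalSpace N] [ChartedSpace E' N]
  {F : TangentBundle 𝓘(ℝ, E) M → ℝ} {F' : TangentBundle 𝓘(ℝ, E') N → ℝ} {φ : M → N}

lemma IsFinslerIsometry.isLocalFinslerIsometry (h : IsFinslerIsometry F F' φ) :
    IsLocalFinslerIsometry F F' φ := by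
  obtain ⟨⟨Φ, rfl⟩, hF⟩ := h
  exact fun p => ⟨Φ.toPartialDiffeomorph, Set.mem_univ p, fun _ _ => rfl, fun v _ => hF v⟩

namespace IsLocalFinslerIsometry

lemma isLocalDiffeomorph (h : IsLocalFinslerIsometry F F' φ) :
    IsLocalDiffeomorph 𝓘(ℝ, E) 𝓘(ℝ, E') ∞ φ := fun p =>
  let ⟨Φ, hp, heq, _⟩ := h p
  ⟨Φ, hp, heq⟩

lemma apply_tangentMap (h : IsLocalFinslerIsometry F F' φ) (v : TangentBundle 𝓘(ℝ, E) M) :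
    F' (tangentMap 𝓘(ℝ, E) 𝓘(ℝ, E') φ v) = F v :=
  let ⟨_, hp, _, hF⟩ := h v.1
  hF v hp

lemma bijective_mfderiv (h : IsLocalFinslerIsometry F F' φ) (p : M) :
    Function.Bijective (mfderiv 𝓘(ℝ, E) 𝓘(ℝ, E') φ p) :=
  ((h.isLocalDiffeomorph p).mfderivToContinuousLinearEquiv (by simp)).bijective

lemma tangentMap_mem_slit (h : IsLocalFinslerIsometry F F' φ) {v : TangentBundle 𝓘(ℝ, E) M} :
    tangentMap 𝓘(ℝ, E) 𝓘(ℝ, E') φ v ∈ slit E' N ↔ v ∈ slit E M :=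
  not_congr (map_eq_zero_iff (mfderiv 𝓘(ℝ, E) 𝓘(ℝ, E') φ v.1) (h.bijective_mfderiv v.1).1)

variable [IsManifold 𝓘(ℝ, E) ∞ M] [IsManifold 𝓘(ℝ, E') ∞ N]

lemma isSprayValue_mfderiv_tangentMap (h : IsLocalFinslerIsometry F F' φ)
    (hF' : IsFinslerFunction F') {v : TangentBundle 𝓘(ℝ, E) M} (hv : v ∈ slit E M)
    {ξ : TangentSpace 𝓘(ℝ, E).tangent v} (hξ : IsSprayValue F v ξ) :
    IsSprayValue F' (tangentMap 𝓘(ℝ, E) 𝓘(ℝ, E') φ v)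
      (mfderiv 𝓘(ℝ, E).tangent 𝓘(ℝ, E').tangent (tangentMap 𝓘(ℝ, E) 𝓘(ℝ, E') φ) v ξ) := by
  have henergy (w : TangentBundle 𝓘(ℝ, E) M) :
      energy F' (tangentMap 𝓘(ℝ, E) 𝓘(ℝ, E') φ w) = 1 ^ 2 * energy F w := by
    rw [one_pow, one_mul, energy, h.apply_tangentMap, energy]
  have hmap := hF'.isSprayValue_map_scaledTangentMap (F := F) (v := v) one_ne_zero
    h.isLocalDiffeomorph.contMDiff
  rw [scaledTangentMap_one] at hmap
  have hval := hmap henergy (h.tangentMap_mem_slit.2 hv) (h.bijective_mfderiv v.1).2 hξ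
  rwa [one_smul] at hval

lemma mfderiv_tangentMap_canonicalSpray (h : IsLocalFinslerIsometry F F' φ)
    (hF' : IsFinslerFunction F')
    {S : ∀ v : TangentBundle 𝓘(ℝ, E) M, TangentSpace 𝓘(ℝ, E).tangent v}
    {S' : ∀ v : TangentBundle 𝓘(ℝ, E') N, TangentSpace 𝓘(ℝ, E').tangent v}
    (hS : IsCanonicalSpray F S) (hS' : IsCanonicalSpray F' S') (v : TangentBundle 𝓘(ℝ, E) M) :
    mfderiv 𝓘(ℝ, E).tangent 𝓘(ℝ, E').tangent (tangentMap 𝓘(ℝ, E) 𝓘(ℝ, E') φ) v (S v) =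
      S' (tangentMap 𝓘(ℝ, E) 𝓘(ℝ, E') φ v) := by
  by_cases hv : v ∈ slit E M
  · have hv' := h.tangentMap_mem_slit.2 hv
    exact hF'.eq_of_isSprayValue hv'
      (h.isSprayValue_mfderiv_tangentMap hF' hv (hS.eq v hv)) (hS'.eq _ hv')
  · rw [hS.isSpray.eq_zero hv, hS'.isSpray.eq_zero (mt h.tangentMap_mem_slit.1 hv), map_zero]

end IsLocalFinslerIsometry

end Isometry

section Geodesic

variable {E : Type*} [NormedAddCommGroup E] [NormedSpace ℝ E]
  {M : Type*} [TopologicalSpace M] [ChartedSpace E M]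
  {E' : Type*} [NormedAddCommGroup E'] [NormedSpace ℝ E']
  {N : Type*} [TopologicalSpace N] [ChartedSpace E' N] {φ : M → N} {γ : ℝ → M} {s : Set ℝ}

lemma velocity_comp {t : ℝ} (hφ : MDifferentiableAt 𝓘(ℝ, E) 𝓘(ℝ, E') φ (γ t))
    (hs : UniqueDiffWithinAt ℝ s t) (hγ : MDifferentiableWithinAt 𝓘(ℝ, ℝ) 𝓘(ℝ, E) γ s t) :
    velocity (φ ∘ γ) s t = tangentMap 𝓘(ℝ, E) 𝓘(ℝ, E') φ (velocity γ s t) :=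
  congrArg (fun A : ℝ →L[ℝ] E' => (⟨φ (γ t), A 1⟩ : TangentBundle 𝓘(ℝ, E') N))
    (mfderiv_comp_mfderivWithin (I := 𝓘(ℝ, ℝ)) t hφ hγ hs.uniqueMDiffWithinAt)

lemma IsSprayGeodesic.comp [IsManifold 𝓘(ℝ, E) ∞ M] [IsManifold 𝓘(ℝ, E') ∞ N]
    {S : ∀ v : TangentBundle 𝓘(ℝ, E) M, TangentSpace 𝓘(ℝ, E).tangent v}
    {S' : ∀ v : TangentBundle 𝓘(ℝ, E') N, TangentSpace 𝓘(ℝ, E').tangent v}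
    (hγ : IsSprayGeodesic S γ s) (hs : UniqueDiffOn ℝ s)
    (hφ : ContMDiff 𝓘(ℝ, E) 𝓘(ℝ, E') ∞ φ)
    (hrel : ∀ v : TangentBundle 𝓘(ℝ, E) M,
      mfderiv 𝓘(ℝ, E).tangent 𝓘(ℝ, E').tangent (tangentMap 𝓘(ℝ, E) 𝓘(ℝ, E') φ) v (S v) =
        S' (tangentMap 𝓘(ℝ, E) 𝓘(ℝ, E') φ v)) :
    IsSprayGeodesic S' (φ ∘ γ) s := by
  have hvel {t : ℝ} (ht : t ∈ s) :
      velocity (φ ∘ γ) s t = tangentMap 𝓘(ℝ, E) 𝓘(ℝ, E') φ (velocity γ s t) :=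
    velocity_comp (hφ.mdifferentiableAt (by simp)) (hs t ht)
      ((hγ.1 t ht).mdifferentiableWithinAt (by simp))
  have hφ' : ContMDiff 𝓘(ℝ, E).tangent 𝓘(ℝ, E').tangent ∞ (tangentMap 𝓘(ℝ, E) 𝓘(ℝ, E') φ) :=
    hφ.contMDiff_tangentMap (by simp)
  refine ⟨hφ.comp_contMDiffOn hγ.1, fun t ht => ?_⟩
  have hlift := (HasMFDerivAt.comp_hasMFDerivWithinAt t
    (hφ'.mdifferentiableAt (x := velocity γ s t) (by simp)).hasMFDerivAt
    (hγ.2 t ht)).congr_of_eventuallyEq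
      (Filter.eventually_of_mem self_mem_nhdsWithin fun _ => hvel) (hvel ht)
  rw [hvel ht, ← hrel]
  refine hlift.congr_mfderiv (ContinuousLinearMap.ext fun (r : ℝ) => ?_)
  exact map_smul (mfderiv 𝓘(ℝ, E).tangent 𝓘(ℝ, E').tangent (tangentMap 𝓘(ℝ, E) 𝓘(ℝ, E') φ)
    (velocity γ s t)) r (S (velocity γ s t))

end Geodesic

end FinslerGeometry

end

open FinslerGeometry in
theorem proposition3p2_general
    {E : Type*} [NormedAddCommGroup E] [NormedSpace ℝ E]
    {M : Type*} [TopologicalSpace M] [ChartedSpace E M] [IsManifold 𝓘(ℝ, E) ∞ M]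
    {E' : Type*} [NormedAddCommGroup E'] [NormedSpace ℝ E'] [FiniteDimensional ℝ E']
    {N : Type*} [TopologicalSpace N] [ChartedSpace E' N] [IsManifold 𝓘(ℝ, E') ∞ N]
    {F : TangentBundle 𝓘(ℝ, E) M → ℝ} {F' : TangentBundle 𝓘(ℝ, E') N → ℝ}
    (hF' : IsFinslerFunction F') {φ : M → N} (hφ : IsLocalFinslerIsometry F F' φ) :
    (∀ (s : Set ℝ) (γ : ℝ → M), UniqueDiffOn ℝ s →
      IsFinslerGeodesic F γ s → IsFinslerGeodesic F' (φ ∘ γ) s) ∧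
    (∀ S S', IsCanonicalSpray F S → IsCanonicalSpray F' S' →
      ∀ v : TangentBundle 𝓘(ℝ, E) M,
        mfderiv 𝓘(ℝ, E).tangent 𝓘(ℝ, E').tangent (tangentMap 𝓘(ℝ, E) 𝓘(ℝ, E') φ) v (S v)
          = S' (tangentMap 𝓘(ℝ, E) 𝓘(ℝ, E') φ v)) := by
  refine ⟨fun s γ hs ⟨S, hS, hγ⟩ => ?_,
    fun S S' hS hS' => hφ.mfderiv_tangentMap_canonicalSpray hF' hS hS'⟩
  obtain ⟨S', hS'⟩ := hF'.exists_isCanonicalSpray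
  exact ⟨S', hS', hγ.comp hs hφ.isLocalDiffeomorph.contMDiff
    (hφ.mfderiv_tangentMap_canonicalSpray hF' hS hS')⟩

open FinslerGeometry in
theorem proposition3p2
    {E : Type*} [NormedAddCommGroup E] [NormedSpace ℝ E] [FiniteDimensional ℝ E]
    {M : Type*} [TopologicalSpace M] [ChartedSpace E M] [IsManifold 𝓘(ℝ, E) ∞ M]
    [T2Space M] [SecondCountableTopology M] [ConnectedSpace M]
    {E' : Type*} [NormedAddCommGroup E'] [NormedSpace ℝ E'] [FiniteDimensional ℝ E']
    {N : Type*} [TopologicalSpace N] [ChartedSpace E' N] [IsManifold 𝓘(ℝ, E') ∞ N]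
    [T2Space N] [SecondCountableTopology N] [ConnectedSpace N]
    (F : TangentBundle 𝓘(ℝ, E) M → ℝ) (hF : IsFinslerFunction F)
    (F' : TangentBundle 𝓘(ℝ, E') N → ℝ) (hF' : IsFinslerFunction F')
    (φ : M → N) (hφ : IsFinslerIsometry F F' φ ∨ IsLocalFinslerIsometry F F' φ) :
    (∀ (s : Set ℝ) (γ : ℝ → M), s.OrdConnected → s.Nontrivial →
      IsFinslerGeodesic F γ s → IsFinslerGeodesic F' (φ ∘ γ) s) ∧
    (∀ S S', IsCanonicalSpray F S → IsCanonicalSpray F' S' →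
      ∀ v : TangentBundle 𝓘(ℝ, E) M,
        mfderiv 𝓘(ℝ, E).tangent 𝓘(ℝ, E').tangent (tangentMap 𝓘(ℝ, E) 𝓘(ℝ, E') φ) v (S v)
          = S' (tangentMap 𝓘(ℝ, E) 𝓘(ℝ, E') φ v)) := by
  have hgeneral := proposition3p2_general hF' (hφ.elim (·.isLocalFinslerIsometry) id)
  exact ⟨fun s γ hs hne => hgeneral.1 s γ (uniqueDiffOn_convex hs.convex
    (hs.convex.nontrivial_iff_nonempty_interior.1 hne)), hgeneral.2⟩
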